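/- **Proposition 2 (Asynchronous Federated Sinkhorn all-to-all algorithm convergence).** Let $c,m\ge 1$, $n=cm$, let $a,b\in\mathbb{R}^n$ have strictly positive entries and equal total mass $\sum_p a_p=\sum_p b_p$, let $C\in\mathbb{R}^{n\times n}$ have finite nonnegative entries, let $\epsilon>0$, and let $K=e^{-C/\epsilon}$ (entrywise). The vectors are split into $c$ blocks of length $m$; client $i\in\{1,\dots,c\}$ owns the blocks $a_i,b_i,u_i,v_i$ and the $i$-th block rows $K_i$ of $K$ and $(K^\top)_i$ of $K^\top$. In the damped asynchronous all-to-all federated Sinkhorn algorithm with step size $\alpha$, started from strictly positive vectors $u^0,v^0\in\mathbb{R}^n$ known to all clients, each client $i$ alternates forever between the two half-steps $$u_i\leftarrow \alpha\,\frac{a_i}{K_i\hat v}+(1-\alpha)u_i,\qquad v_i\leftarrow \alpha\,\frac{b_i}{(K^\top)_i\hat u}+(1-\alpha)v_i$$ (componentwise division), beginning with the first, without waiting for the other clients. Here $\hat v$ and $\hat u$ are the client's local copies of $v$ and $u$: their $i$-th blocks are its own current ones, while the other blocks may be outdated, with different ages. Let $u^t,v^t$ be the vectors of the blocks held by their owners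 at time $t=0,1,2,\dots$ of a global clock. A *schedule* specifies which clients complete a half-step in each time unit and which past versions of the other blocks they use; its asynchrony is *bounded by* $\tau\in\mathbb{N}$ if the versions used are at most $\tau$ time units old and every client completes at least one half-step in any $\tau+1$ consecutive time units. Then the entropy-regularized optimal transport problem $$\min_{P\in\mathbb{R}^{n\times n}}\ \langle P,C\rangle+\epsilon\sum_{p,q}P_{pq}(\log P_{pq}-1)\quad\text{subject to } P\mathbf 1=a,\ P^\top\mathbf 1=b,\ P\ge 0$$ has a unique solution $P^*$. The Sinkhorn iteration has a positive fixed point, that is, a pair of positive vectors with $u=a/(Kv)$, $v=b/(K^\top u)$; it is unique up to the scaling $(u,v)\mapsto(su,s^{-1}v)$, $s>0$; and $\operatorname{diag}(u)K\operatorname{diag}(v)=P^*$ for every positive fixed point. Moreover, for every $\tau\in\mathbb{N}$ there is $\alpha_0\in(0,1]$, depending only on $c,m,a,b,C,\epsilon,\tau$, such that for every $0<\alpha<\alpha_0$ the algorithm converges linearly: there is $\rho\in(0,1)$, and for all positive $u^0,v^0$ there is $M$, such that for every schedule with asynchrony bounded by $\tau$ there is a positive fixed point $(u^*,v^*)$ with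 $$|u^t_p-u^*_p|\le M\rho^t,\qquad |v^t_p-v^*_p|\le M\rho^t,\qquad \bigl|\bigl(\operatorname{diag}(u^t)K\operatorname{diag}(v^t)-P^*\bigr)_{pq}\bigr|\le M\rho^t$$ for all $t\ge 0$ and all $p,q\in\{1,\dots,n\}$. -/

import Mathlib

open scoped Matrix

noncomputable section

/-- The Gibbs kernel `K = exp (-C / ε)` (entrywise exponential) of a cost matrix `C`. -/
def gibbsKernel {ι : Type*} (C : Matrix ι ι ℝ) (ε : ℝ) : Matrix ι ι ℝ :=
  Matrix.of fun p q => Real.exp (-C p q / ε)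

/-- The entropy-regularized transport cost `⟨P, C⟩ + ε ∑ P_pq (log P_pq - 1)`. Since
`Real.log 0 = 0` in Mathlib, the usual convention `0 log 0 = 0` is in force. -/
def entropicCost {ι : Type*} [Fintype ι] (C : Matrix ι ι ℝ) (ε : ℝ) (P : Matrix ι ι ℝ) : ℝ :=
  (∑ p, ∑ q, P p q * C p q) + ε * ∑ p, ∑ q, P p q * (Real.log (P p q) - 1)

/-- The transport plans with marginals `a` and `b`. -/
def transportPlans {ι : Type*} [Fintype ι] (a b : ι → ℝ) : Set (Matrix ι ι ℝ) :=
  {P | (∀ p q, 0 ≤ P p q) ∧ P *ᵥ 1 = a ∧ Pᵀ *ᵥ 1 = b}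

/-- `P` solves the entropy-regularized optimal transport problem: it is a transport plan of
least regularized cost. -/
def IsEntropicOTSolution {ι : Type*} [Fintype ι] (C : Matrix ι ι ℝ) (ε : ℝ) (a b : ι → ℝ)
    (P : Matrix ι ι ℝ) : Prop :=
  P ∈ transportPlans a b ∧ ∀ Q ∈ transportPlans a b, entropicCost C ε P ≤ entropicCost C ε Q

/-- The matrix `diag(u) K diag(v)`. -/
def scaledKernel {ι : Type*} [Fintype ι] [DecidableEq ι] (K : Matrix ι ι ℝ) (u v : ι → ℝ) :
    Matrix ι ι ℝ :=
  Matrix.diagonal u * K * Matrix.diagonal v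

/-- `(u, v)` is a positive fixed point of the Sinkhorn iteration `u = a / (K v)`,
`v = b / (Kᵀ u)` (componentwise division). -/
structure IsSinkhornFixedPoint {ι : Type*} [Fintype ι] (K : Matrix ι ι ℝ) (a b u v : ι → ℝ) :
    Prop where
  u_pos : ∀ p, 0 < u p
  v_pos : ∀ p, 0 < v p
  u_eq : ∀ p, u p = a p / (K *ᵥ v) p
  v_eq : ∀ p, v p = b p / (Kᵀ *ᵥ u) p

/-- A schedule of an asynchronous all-to-all execution with `c` clients, on a global clock which
the clients do not know. -/
structure AsyncSchedule (c : ℕ) where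
  /-- the clients that complete a local half-step between time `t` and time `t + 1` -/
  active : ℕ → Finset (Fin c)
  /-- `stamp t i j` is a time at which the block of client `j` had the value which client `i` uses
  for it in the half-step completed between `t` and `t + 1`: the age of the message from `j` that
  `i` works with is at most `t - stamp t i j` -/
  stamp : ℕ → Fin c → Fin c → ℕ

namespace AsyncSchedule

variable {c : ℕ}

/-- Number of half-steps that client `i` has completed by time `t`. Each client alternates
between updating its own block of `u` (after an even number of half-steps) and its own block of
`v` (after an odd number of half-steps). -/
def halfSteps (S : AsyncSchedule c) (t : ℕ) (i : Fin c) : ℕ :=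
  Nat.count (fun s => i ∈ S.active s) t

/-- The copy of the full vector `w` (with trajectory `w 0, w 1, …` and one block of length `m` per
client) that client `i` works with at time `t`; different blocks may have different ages. -/
def read (S : AsyncSchedule c) {m : ℕ} (w : ℕ → Fin c × Fin m → ℝ) (t : ℕ) (i : Fin c) :
    Fin c × Fin m → ℝ :=
  fun q => w (S.stamp t i q.1) q

/-- The asynchrony is bounded by `τ`: messages come from the past and are at most `τ` time units
old, every client knows its own current block, and every client completes at least one half-step
in any `τ + 1` consecutive time units. -/
structure IsBounded (S : AsyncSchedule c) (τ : ℕ) : Prop where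
  stamp_le : ∀ t i j, S.stamp t i j ≤ t
  le_stamp_add : ∀ t i j, t ≤ S.stamp t i j + τ
  stamp_self : ∀ t i, S.stamp t i i = t
  exists_active : ∀ t i, ∃ s, t ≤ s ∧ s ≤ t + τ ∧ i ∈ S.active s

end AsyncSchedule

/-- The sequences `u`, `v` are the run, under the schedule `S`, of the damped asynchronous
all-to-all federated Sinkhorn algorithm with step size `α`: an active client `i` replaces its own
block `u_i` by `α a_i / (K_i v̂) + (1 - α) u_i` or, when it is the turn of `v`, its own block `v_i`
by `α b_i / ((Kᵀ)_i û) + (1 - α) v_i`, where `v̂`, `û` are its local, possibly outdated, copies of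
the full vectors. Nothing else changes. The entry `u t (i, k)` is the `k`-th component of the block
that client `i` owns, at time `t`. -/
structure IsAsyncSinkhornRun {c m : ℕ} (K : Matrix (Fin c × Fin m) (Fin c × Fin m) ℝ)
    (a b : Fin c × Fin m → ℝ) (α : ℝ) (S : AsyncSchedule c) (u v : ℕ → Fin c × Fin m → ℝ) :
    Prop where
  u_step : ∀ t i k, u (t + 1) (i, k) =
    if i ∈ S.active t ∧ Even (S.halfSteps t i) then
      α * (a (i, k) / (K *ᵥ S.read v t i) (i, k)) + (1 - α) * u t (i, k)
    else u t (i, k)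
  v_step : ∀ t i k, v (t + 1) (i, k) =
    if i ∈ S.active t ∧ Odd (S.halfSteps t i) then
      α * (b (i, k) / (Kᵀ *ᵥ S.read u t i) (i, k)) + (1 - α) * v t (i, k)
    else v t (i, k)

end

/-! A maximizer of the scale-invariant `semiDual` over positive vectors is a critical point, and the
critical equations are the Sinkhorn equations (`exists_isSinkhornFixedPoint`). If P = diag(u) K
diag(v) comes from a fixed point, the excess cost of a transport plan Q over P is ε times the
relative entropy of Q with respect to P. So P is the unique minimizer, the same for all fixed
points, and cancelling K leaves only the scaling freedom.

For convergence, fix one fixed point (us, vs) and follow the ratios x = u / us and y = vs / v. Since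
P has row sums a and column sums b, a u-step averages x_p with a harmonic mean of delayed entries of
y, and a v-step replaces y_q by a harmonic mean of itself and an arithmetic mean of delayed entries
of x. Both results are convex combinations (`IsDelayedMean`), with weights at least a constant times
lo / hi while the entries lie in [lo, hi]. The algorithm is thus a delayed consensus process: an
interval containing a full delay window of entries is never left, and within one mixing time the gap
of a single entry to an end of the interval spreads to all entries, so the interval shrinks by a
fixed factor (`IsTrapped.contract`). This works for every α < 1, whatever τ is.

The factor depends on lo / hi, hence on the initial vectors. After finitely many mixing times hi ≤ 2
lo, and from then on the rate is universal; the transient only enlarges M (`exists_consensus_rate`).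
A common limit l of all ratios means convergence to (l us, l⁻¹ vs). -/

/-! ### Existence of Sinkhorn fixed points -/

section FixedPoint

variable {ι : Type*} [Fintype ι]

omit [Fintype ι] in
theorem gibbsKernel_pos (C : Matrix ι ι ℝ) (ε : ℝ) (p q : ι) : 0 < gibbsKernel C ε p q :=
  Real.exp_pos _

theorem mulVec_pos_of_pos [Nonempty ι] {K : Matrix ι ι ℝ} (hK : ∀ p q, 0 < K p q) {v : ι → ℝ}
    (hv : ∀ p, 0 < v p) (p : ι) : 0 < (K *ᵥ v) p :=
  Finset.sum_pos (fun q _ => mul_pos (hK p q) (hv q)) Finset.univ_nonempty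

theorem mulVec_pos_of_nonneg {K : Matrix ι ι ℝ} (hK : ∀ p q, 0 < K p q) {v : ι → ℝ}
    (hv : ∀ p, 0 ≤ v p) (hsum : ∑ p, v p = 1) (p : ι) : 0 < (K *ᵥ v) p := by
  obtain ⟨q, -, hq⟩ : ∃ q ∈ Finset.univ, 0 < v q :=
    Finset.exists_lt_of_sum_lt (f := fun _ => (0 : ℝ)) (by simp [hsum])
  exact Finset.sum_pos' (fun q _ => mul_nonneg (hK p q).le (hv q))
    ⟨q, Finset.mem_univ _, mul_pos (hK p q) hq⟩

/-- The logarithm of `∏ u_p ^ a_p / ∏ (Kᵀ u)_q ^ b_q`, the semi-dual objective of entropic optimal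
transport. -/
noncomputable def semiDual (K : Matrix ι ι ℝ) (a b u : ι → ℝ) : ℝ :=
  ∑ p, a p * Real.log (u p) - ∑ q, b q * Real.log ((Kᵀ *ᵥ u) q)

theorem semiDual_smul [Nonempty ι] {K : Matrix ι ι ℝ} (hK : ∀ p q, 0 < K p q) {a b u : ι → ℝ}
    (hab : ∑ p, a p = ∑ p, b p) (hu : ∀ p, 0 < u p) {s : ℝ} (hs : 0 < s) :
    semiDual K a b (s • u) = semiDual K a b u := by
  have h1 : ∀ p, a p * Real.log ((s • u) p) = a p * Real.log s + a p * Real.log (u p) := by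
    intro p
    rw [Pi.smul_apply, smul_eq_mul, Real.log_mul hs.ne' (hu p).ne']; ring
  have h2 : ∀ q, b q * Real.log ((Kᵀ *ᵥ (s • u)) q)
      = b q * Real.log s + b q * Real.log ((Kᵀ *ᵥ u) q) := by
    intro q
    have := mulVec_pos_of_pos (K := Kᵀ) (fun p q => hK q p) hu q
    rw [Matrix.mulVec_smul, Pi.smul_apply, smul_eq_mul, Real.log_mul hs.ne' this.ne']; ring
  unfold semiDual
  simp only [h1, h2, Finset.sum_add_distrib, ← Finset.sum_mul, hab]
  ring

/-- By scale invariance it suffices to maximize over the simplex. The exponential `Ψ` of the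
objective is continuous up to the boundary, because Kᵀu stays positive there, and it vanishes where
some u_p = 0, because a_p > 0. So the maximizer on the compact simplex is interior. -/
theorem exists_semiDual_max [Nonempty ι] {K : Matrix ι ι ℝ} (hK : ∀ p q, 0 < K p q)
    {a b : ι → ℝ} (ha : ∀ p, 0 < a p) (hab : ∑ p, a p = ∑ p, b p) :
    ∃ u : ι → ℝ, (∀ p, 0 < u p) ∧
      ∀ w : ι → ℝ, (∀ p, 0 < w p) → semiDual K a b w ≤ semiDual K a b u := by
  classical
  have hKt : ∀ p q, 0 < Kᵀ p q := fun p q => hK q p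
  let Ψ : (ι → ℝ) → ℝ := fun u => (∏ p, u p ^ a p) * ∏ q, (Kᵀ *ᵥ u) q ^ (-b q)
  have hpos : ∀ u, (∀ p, 0 < u p) → 0 < Ψ u ∧ Real.log (Ψ u) = semiDual K a b u := by
    intro u hu
    have hKu := mulVec_pos_of_pos hKt hu
    have h1 : ∀ p, 0 < u p ^ a p := fun p => Real.rpow_pos_of_pos (hu p) _
    have h2 : ∀ q, 0 < (Kᵀ *ᵥ u) q ^ (-b q) := fun q => Real.rpow_pos_of_pos (hKu q) _
    have h3 := Finset.prod_pos fun p (_ : p ∈ Finset.univ) => h1 p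
    have h4 := Finset.prod_pos fun p (_ : p ∈ Finset.univ) => h2 p
    refine ⟨mul_pos h3 h4, ?_⟩
    simp only [Ψ]
    rw [Real.log_mul h3.ne' h4.ne', Real.log_prod (fun p _ => (h1 p).ne'),
      Real.log_prod (fun p _ => (h2 p).ne')]
    simp only [Real.log_rpow (hu _), Real.log_rpow (hKu _), semiDual, neg_mul,
      Finset.sum_neg_distrib]
    ring
  have hcont : ContinuousOn Ψ (stdSimplex ℝ ι) := by
    refine ContinuousOn.mul ?_ ?_
    · refine continuousOn_finsetProd _ fun p _ => ?_
      exact ((continuous_apply p).continuousOn).rpow_const fun u _ => Or.inr (ha p).le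
    · refine continuousOn_finsetProd _ fun q _ => ?_
      refine ContinuousOn.rpow_const ?_ fun u hu =>
        Or.inl (mulVec_pos_of_nonneg hKt hu.1 hu.2 q).ne'
      exact (((continuous_apply q).comp
        (Continuous.matrix_mulVec continuous_const continuous_id))).continuousOn
  have hne : (stdSimplex ℝ ι).Nonempty := ⟨_, single_mem_stdSimplex ℝ (Classical.arbitrary ι)⟩
  obtain ⟨u, hu, hmax⟩ := (isCompact_stdSimplex ℝ ι).exists_isMaxOn hne hcont
  have hsimplex : ∀ w : ι → ℝ, (∀ p, 0 < w p) → 0 < ∑ p, w p ∧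
      (∑ p, w p)⁻¹ • w ∈ stdSimplex ℝ ι ∧ ∀ p, 0 < ((∑ p, w p)⁻¹ • w) p := by
    intro w hw
    have hs : 0 < ∑ p, w p := Finset.sum_pos (fun p _ => hw p) Finset.univ_nonempty
    have hp : ∀ p, 0 < ((∑ p, w p)⁻¹ • w) p := fun p => mul_pos (inv_pos.2 hs) (hw p)
    refine ⟨hs, ⟨fun p => (hp p).le, ?_⟩, hp⟩
    simp only [Pi.smul_apply, smul_eq_mul, ← Finset.mul_sum]
    exact inv_mul_cancel₀ hs.ne'
  have hΨu : 0 < Ψ u := by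
    obtain ⟨-, h1, h2⟩ := hsimplex 1 (fun _ => one_pos)
    exact (hpos _ h2).1.trans_le (hmax h1)
  have hupos : ∀ p, 0 < u p := by
    intro p
    refine (hu.1 p).lt_of_ne fun h0 => hΨu.ne' ?_
    have : ∏ p, u p ^ a p = 0 :=
      Finset.prod_eq_zero (Finset.mem_univ p) (by rw [← h0, Real.zero_rpow (ha p).ne'])
    simp only [Ψ, this, zero_mul]
  refine ⟨u, hupos, fun w hw => ?_⟩
  obtain ⟨hs, h1, h2⟩ := hsimplex w hw
  rw [← semiDual_smul hK hab hw (inv_pos.2 hs), ← (hpos _ h2).2, ← (hpos u hupos).2]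
  exact Real.log_le_log (hpos _ h2).1 (hmax h1)

theorem hasDerivAt_semiDual_add_single [Nonempty ι] [DecidableEq ι] {K : Matrix ι ι ℝ}
    (hK : ∀ p q, 0 < K p q) (a b : ι → ℝ) {u : ι → ℝ} (hu : ∀ p, 0 < u p) (p : ι) :
    HasDerivAt (fun s : ℝ => semiDual K a b (u + s • Pi.single p 1))
      (a p / u p - ∑ q, K p q * (b q / (Kᵀ *ᵥ u) q)) 0 := by
  have hKu := mulVec_pos_of_pos (K := Kᵀ) (fun p q => hK q p) hu
  have h1 : HasDerivAt (fun s : ℝ => ∑ r, a r * Real.log ((u + s • (Pi.single p 1 : ι → ℝ)) r))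
      (∑ r, a r * ((Pi.single p (1 : ℝ) : ι → ℝ) r / u r)) 0 := by
    refine HasDerivAt.fun_sum fun r _ => HasDerivAt.const_mul _ ?_
    have : HasDerivAt (fun s : ℝ => (u + s • (Pi.single p 1 : ι → ℝ)) r)
        ((Pi.single p (1 : ℝ) : ι → ℝ) r) 0 := by
      simpa using ((hasDerivAt_id (0 : ℝ)).mul_const
        ((Pi.single p (1 : ℝ) : ι → ℝ) r)).const_add (u r)
    have h := this.log (by simpa using (hu r).ne')
    simpa using h
  have h2 : HasDerivAt (fun s : ℝ => ∑ q, b q * Real.log ((Kᵀ *ᵥ (u + s • Pi.single p 1)) q))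
      (∑ q, b q * (K p q / (Kᵀ *ᵥ u) q)) 0 := by
    refine HasDerivAt.fun_sum fun q _ => HasDerivAt.const_mul _ ?_
    have : HasDerivAt (fun s : ℝ => (Kᵀ *ᵥ (u + s • Pi.single p (1 : ℝ))) q) (K p q) 0 := by
      have h := ((hasDerivAt_id (0 : ℝ)).mul_const (K p q)).const_add ((Kᵀ *ᵥ u) q)
      simpa [Matrix.mulVec_add, Matrix.mulVec_smul] using h
    have h := this.log (by simpa using (hKu q).ne')
    simpa using h
  have h3 := h1.fun_sub h2
  refine h3.congr_deriv ?_
  rw [Finset.sum_eq_single p]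
  · simp only [Pi.single_eq_same, mul_one_div, sub_right_inj]
    exact Finset.sum_congr rfl fun q _ => by ring
  · intro r _ hr
    simp [Pi.single_eq_of_ne hr]
  · simp

theorem exists_isSinkhornFixedPoint [Nonempty ι] {K : Matrix ι ι ℝ} (hK : ∀ p q, 0 < K p q)
    {a b : ι → ℝ} (ha : ∀ p, 0 < a p) (hb : ∀ p, 0 < b p) (hab : ∑ p, a p = ∑ p, b p) :
    ∃ u v, IsSinkhornFixedPoint K a b u v := by
  classical
  obtain ⟨u, hu, hmax⟩ := exists_semiDual_max hK ha hab
  have hKu := mulVec_pos_of_pos (K := Kᵀ) (fun p q => hK q p) hu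
  have hv : ∀ q, 0 < b q / (Kᵀ *ᵥ u) q := fun q => div_pos (hb q) (hKu q)
  -- With v defined by its own equation, the vanishing of the p-th partial derivative at the
  -- maximizer reads a_p / u_p = (K v)_p.
  refine ⟨u, fun q => b q / (Kᵀ *ᵥ u) q, hu, hv, fun p => ?_, fun _ => rfl⟩
  have hloc : IsLocalMax (fun s : ℝ => semiDual K a b (u + s • Pi.single p 1)) 0 := by
    have hev : ∀ᶠ s : ℝ in nhds 0, -u p < s := lt_mem_nhds (neg_lt_zero.2 (hu p))
    filter_upwards [hev] with s hs
    simp only [zero_smul, add_zero]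
    refine hmax _ fun r => ?_
    rcases eq_or_ne r p with rfl | hr
    · simp only [Pi.add_apply, Pi.smul_apply, Pi.single_eq_same, smul_eq_mul, mul_one]
      linarith
    · simpa [Pi.single_eq_of_ne hr] using hu r
  have h0 := hloc.hasDerivAt_eq_zero (hasDerivAt_semiDual_add_single hK a b hu p)
  have h1 : a p / u p = (K *ᵥ fun q => b q / (Kᵀ *ᵥ u) q) p := sub_eq_zero.1 h0
  rw [← h1, div_div_cancel₀ (ha p).ne']

namespace IsSinkhornFixedPoint

variable {K : Matrix ι ι ℝ} {a b u v : ι → ℝ}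

theorem sum_row [Nonempty ι] (h : IsSinkhornFixedPoint K a b u v) (hK : ∀ p q, 0 < K p q) (p : ι) :
    ∑ q, u p * K p q * v q = a p := by
  have h1 := mulVec_pos_of_pos hK h.v_pos p
  have h2 := (eq_div_iff h1.ne').1 (h.u_eq p)
  rw [← h2, Matrix.mulVec, dotProduct, Finset.mul_sum]
  exact Finset.sum_congr rfl fun q _ => by ring

theorem sum_col [Nonempty ι] (h : IsSinkhornFixedPoint K a b u v) (hK : ∀ p q, 0 < K p q) (q : ι) :
    ∑ p, u p * K p q * v q = b q := by
  have h1 := mulVec_pos_of_pos (K := Kᵀ) (fun p q => hK q p) h.u_pos q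
  have h2 := (eq_div_iff h1.ne').1 (h.v_eq q)
  rw [← h2, Matrix.mulVec, dotProduct, Finset.mul_sum]
  exact Finset.sum_congr rfl fun p _ => by rw [Matrix.transpose_apply]; ring

theorem smul (h : IsSinkhornFixedPoint K a b u v) {s : ℝ} (hs : 0 < s) :
    IsSinkhornFixedPoint K a b (s • u) (s⁻¹ • v) where
  u_pos p := mul_pos hs (h.u_pos p)
  v_pos p := mul_pos (inv_pos.2 hs) (h.v_pos p)
  u_eq p := by
    rw [Matrix.mulVec_smul, Pi.smul_apply, Pi.smul_apply, h.u_eq p, smul_eq_mul, smul_eq_mul]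
    field_simp
  v_eq p := by
    rw [Matrix.mulVec_smul, Pi.smul_apply, Pi.smul_apply, h.v_eq p, smul_eq_mul, smul_eq_mul]
    field_simp

end IsSinkhornFixedPoint

/-! ### Entropic transport and uniqueness -/

theorem scaledKernel_apply [DecidableEq ι] (K : Matrix ι ι ℝ) (u v : ι → ℝ) (p q : ι) :
    scaledKernel K u v p q = u p * K p q * v q := by
  rw [scaledKernel, Matrix.mul_diagonal, Matrix.diagonal_mul]

theorem mul_log_sub_nonneg {x y : ℝ} (hx : 0 ≤ x) (hy : 0 < y) :
    0 ≤ x * Real.log x - x * Real.log y - x + y := by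
  rcases hx.eq_or_lt with rfl | hx
  · simpa using hy.le
  · have h := mul_le_mul_of_nonneg_left (Real.log_le_sub_one_of_pos (div_pos hy hx)) hx.le
    rw [Real.log_div hy.ne' hx.ne', mul_sub, mul_sub, mul_div_cancel₀ _ hx.ne'] at h
    linarith

theorem eq_of_mul_log_sub_eq_zero {x y : ℝ} (hx : 0 ≤ x) (hy : 0 < y)
    (h0 : x * Real.log x - x * Real.log y - x + y = 0) : x = y := by
  rcases hx.eq_or_lt with rfl | hx
  · simp at h0; exact h0.symm
  · by_contra hne
    have hne' : y / x ≠ 1 := fun h => hne ((div_eq_one_iff_eq hx.ne').1 h).symm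
    have h := mul_lt_mul_of_pos_left (Real.log_lt_sub_one_of_pos (div_pos hy hx) hne') hx
    rw [Real.log_div hy.ne' hx.ne', mul_sub, mul_sub, mul_div_cancel₀ _ hx.ne'] at h
    linarith

/-- Since log P_pq = log u_p - C_pq / ε + log v_q for the scaled kernel P, the cost C can be traded
for log P; the u and v terms see only the marginals of Q, so they are the same for all plans.
Subtracting two instances leaves a relative entropy. -/
theorem entropicCost_sub_eq [Nonempty ι] [DecidableEq ι] {C : Matrix ι ι ℝ} {ε : ℝ} (hε : 0 < ε)
    {a b u v : ι → ℝ} (h : IsSinkhornFixedPoint (gibbsKernel C ε) a b u v) {Q : Matrix ι ι ℝ}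
    (hQ : Q ∈ transportPlans a b) :
    entropicCost C ε Q = ε * (∑ p, a p * Real.log (u p) + ∑ q, b q * Real.log (v q)
      + ∑ p, ∑ q, (Q p q * Real.log (Q p q)
        - Q p q * Real.log (scaledKernel (gibbsKernel C ε) u v p q) - Q p q)) := by
  obtain ⟨-, hrow, hcol⟩ := hQ
  have hr : ∀ p, ∑ q, Q p q = a p := fun p => by
    simpa [Matrix.mulVec, dotProduct] using congrFun hrow p
  have hc : ∀ q, ∑ p, Q p q = b q := fun q => by
    simpa [Matrix.mulVec, dotProduct] using congrFun hcol q
  have h1 : ∑ p, a p * Real.log (u p) = ∑ p, ∑ q, Q p q * Real.log (u p) :=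
    Finset.sum_congr rfl fun p _ => by rw [← hr p, Finset.sum_mul]
  have h2 : ∑ q, b q * Real.log (v q) = ∑ p, ∑ q, Q p q * Real.log (v q) := by
    rw [Finset.sum_comm]
    exact Finset.sum_congr rfl fun q _ => by rw [← hc q, Finset.sum_mul]
  rw [h1, h2, entropicCost]
  simp only [mul_add, Finset.mul_sum, ← Finset.sum_add_distrib]
  refine Finset.sum_congr rfl fun p _ => Finset.sum_congr rfl fun q _ => ?_
  have hK := gibbsKernel_pos C ε p q
  rw [scaledKernel_apply, Real.log_mul (mul_pos (h.u_pos p) hK).ne' (h.v_pos q).ne',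
    Real.log_mul (h.u_pos p).ne' hK.ne']
  have : Real.log (gibbsKernel C ε p q) = -C p q / ε := Real.log_exp _
  rw [this]
  field_simp
  ring

theorem scaledKernel_mem_transportPlans [Nonempty ι] [DecidableEq ι] {K : Matrix ι ι ℝ}
    (hK : ∀ p q, 0 < K p q) {a b u v : ι → ℝ} (h : IsSinkhornFixedPoint K a b u v) :
    scaledKernel K u v ∈ transportPlans a b := by
  refine ⟨fun p q => ?_, funext fun p => ?_, funext fun q => ?_⟩
  · rw [scaledKernel_apply]
    exact (mul_pos (mul_pos (h.u_pos p) (hK p q)) (h.v_pos q)).le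
  · simpa [Matrix.mulVec, dotProduct, scaledKernel_apply] using h.sum_row hK p
  · simpa [Matrix.mulVec, dotProduct, scaledKernel_apply] using h.sum_col hK q

theorem isEntropicOTSolution_iff [Nonempty ι] [DecidableEq ι] {C : Matrix ι ι ℝ} {ε : ℝ}
    (hε : 0 < ε) {a b u v : ι → ℝ} (h : IsSinkhornFixedPoint (gibbsKernel C ε) a b u v)
    (Q : Matrix ι ι ℝ) :
    IsEntropicOTSolution C ε a b Q ↔ Q = scaledKernel (gibbsKernel C ε) u v := by
  set P := scaledKernel (gibbsKernel C ε) u v with hPdef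
  have hP : P ∈ transportPlans a b := scaledKernel_mem_transportPlans (gibbsKernel_pos C ε) h
  have hPpos : ∀ p q, 0 < P p q := fun p q => by
    rw [hPdef, scaledKernel_apply]
    exact mul_pos (mul_pos (h.u_pos p) (gibbsKernel_pos C ε p q)) (h.v_pos q)
  have hdiff : ∀ Q ∈ transportPlans a b, entropicCost C ε Q - entropicCost C ε P
      = ε * ∑ p, ∑ q, (Q p q * Real.log (Q p q) - Q p q * Real.log (P p q) - Q p q + P p q) := by
    intro Q hQ
    rw [entropicCost_sub_eq hε h hQ, entropicCost_sub_eq hε h hP, ← mul_sub, ← hPdef]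
    simp only [Finset.sum_add_distrib, Finset.sum_sub_distrib]
    ring
  have hnn : ∀ Q ∈ transportPlans a b, ∀ p q,
      0 ≤ Q p q * Real.log (Q p q) - Q p q * Real.log (P p q) - Q p q + P p q :=
    fun Q hQ p q => mul_log_sub_nonneg (hQ.1 p q) (hPpos p q)
  constructor
  · rintro ⟨hQ, hmin⟩
    have h1 := hdiff Q hQ
    have h2 : ε * ∑ p, ∑ q,
        (Q p q * Real.log (Q p q) - Q p q * Real.log (P p q) - Q p q + P p q) ≤ 0 := by
      rw [← h1]; linarith [hmin P hP]
    have h3 : ∑ p, ∑ q,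
        (Q p q * Real.log (Q p q) - Q p q * Real.log (P p q) - Q p q + P p q) = 0 :=
      le_antisymm (nonpos_of_mul_nonpos_right h2 hε)
        (Finset.sum_nonneg fun p _ => Finset.sum_nonneg fun q _ => hnn Q hQ p q)
    ext p q
    have h4 := (Finset.sum_eq_zero_iff_of_nonneg fun p _ =>
      Finset.sum_nonneg fun q _ => hnn Q hQ p q).1 h3 p (Finset.mem_univ p)
    have h5 := (Finset.sum_eq_zero_iff_of_nonneg fun q _ => hnn Q hQ p q).1 h4 q
      (Finset.mem_univ q)
    exact eq_of_mul_log_sub_eq_zero (hQ.1 p q) (hPpos p q) h5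
  · rintro rfl
    refine ⟨hP, fun Q hQ => ?_⟩
    rw [← sub_nonneg, hdiff Q hQ]
    exact mul_nonneg hε.le
      (Finset.sum_nonneg fun p _ => Finset.sum_nonneg fun q _ => hnn Q hQ p q)

/-- Cancelling K leaves two factorizations of one rank-one matrix; comparing them in one reference
column gives the scalar s. -/
theorem exists_smul_of_scaledKernel_eq [Nonempty ι] [DecidableEq ι] {K : Matrix ι ι ℝ}
    (hK : ∀ p q, 0 < K p q) {u v u' v' : ι → ℝ} (hu : ∀ p, 0 < u p) (hv : ∀ p, 0 < v p)
    (hu' : ∀ p, 0 < u' p) (hv' : ∀ p, 0 < v' p)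
    (h : scaledKernel K u v = scaledKernel K u' v') :
    ∃ s : ℝ, 0 < s ∧ u' = s • u ∧ v' = s⁻¹ • v := by
  have key : ∀ p q, u p * v q = u' p * v' q := by
    intro p q
    have h1 := congrFun (congrFun h p) q
    rw [scaledKernel_apply, scaledKernel_apply] at h1
    refine mul_left_cancel₀ (hK p q).ne' ?_
    linarith
  obtain ⟨r⟩ := ‹Nonempty ι›
  have hs : 0 < v r / v' r := div_pos (hv r) (hv' r)
  refine ⟨v r / v' r, hs, funext fun p => ?_, funext fun q => ?_⟩
  · rw [Pi.smul_apply, smul_eq_mul, div_mul_eq_mul_div, eq_div_iff (hv' r).ne', ← key p r]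
    ring
  · have h1 := key r q
    have h2 := key r r
    have h3 := hu r
    have h4 := hu' r
    have h5 := hv r
    rw [Pi.smul_apply, smul_eq_mul, inv_div, div_mul_eq_mul_div, eq_div_iff h5.ne']
    refine mul_left_cancel₀ (mul_pos h3 h4).ne' ?_
    linear_combination -(u r * v r) * h1 + (u r * v q) * h2

end FixedPoint

/-! ### Consensus of delayed means -/

section Consensus

variable {ι : Type*} [Fintype ι]

/-- `new` is a convex combination of `old` and of the entries of `y`, read at times between
`t - τ` and `t`, in which all coefficients are at least `κ`. -/
def IsDelayedMean (κ : ℝ) (τ t : ℕ) (y : ℕ → ι → ℝ) (old new : ℝ) : Prop :=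
  ∃ (w₀ : ℝ) (w : ι → ℝ) (σ : ι → ℕ), κ ≤ w₀ ∧ (∀ q, κ ≤ w q) ∧ w₀ + ∑ q, w q = 1 ∧
    (∀ q, σ q ≤ t ∧ t ≤ σ q + τ) ∧ new = w₀ * old + ∑ q, w q * y (σ q) q

namespace IsDelayedMean

variable {κ : ℝ} {τ t : ℕ} {y : ℕ → ι → ℝ} {old new : ℝ}

theorem neg (h : IsDelayedMean κ τ t y old new) : IsDelayedMean κ τ t (-y) (-old) (-new) := by
  obtain ⟨w₀, w, σ, h1, h2, h3, h4, h5⟩ := h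
  refine ⟨w₀, w, σ, h1, h2, h3, h4, ?_⟩
  simp only [Pi.neg_apply, mul_neg, Finset.sum_neg_distrib, h5]
  ring

theorem mono (h : IsDelayedMean κ τ t y old new) {κ' : ℝ} (hκ : κ' ≤ κ) :
    IsDelayedMean κ' τ t y old new := by
  obtain ⟨w₀, w, σ, h1, h2, h3⟩ := h
  exact ⟨w₀, w, σ, hκ.trans h1, fun q => hκ.trans (h2 q), h3⟩

/-- The gap below an upper bound is the same convex combination of gaps. -/
theorem exists_gap_eq (h : IsDelayedMean κ τ t y old new) (hi : ℝ) :
    ∃ (w₀ : ℝ) (w : ι → ℝ) (σ : ι → ℕ), κ ≤ w₀ ∧ (∀ q, κ ≤ w q) ∧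
      (∀ q, σ q ≤ t ∧ t ≤ σ q + τ) ∧
      hi - new = w₀ * (hi - old) + ∑ q, w q * (hi - y (σ q) q) := by
  obtain ⟨w₀, w, σ, h1, h2, h3, h4, h5⟩ := h
  refine ⟨w₀, w, σ, h1, h2, h4, ?_⟩
  simp only [mul_sub, Finset.sum_sub_distrib, ← Finset.sum_mul, h5]
  linear_combination -hi * h3

variable {hi : ℝ} (hold : old ≤ hi) (hy : ∀ s ≤ t, t ≤ s + τ → ∀ q, y s q ≤ hi)
include hold hy

theorem mul_gap_old_le (h : IsDelayedMean κ τ t y old new) (hκ : 0 ≤ κ) :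
    κ * (hi - old) ≤ hi - new := by
  obtain ⟨w₀, w, σ, h1, h2, h4, h5⟩ := h.exists_gap_eq hi
  have h6 : 0 ≤ ∑ q, w q * (hi - y (σ q) q) := Finset.sum_nonneg fun q _ =>
    mul_nonneg (hκ.trans (h2 q)) (sub_nonneg.2 (hy _ (h4 q).1 (h4 q).2 q))
  have h7 := mul_le_mul_of_nonneg_right h1 (sub_nonneg.2 hold)
  linarith

theorem exists_mul_gap_le (h : IsDelayedMean κ τ t y old new) (hκ : 0 ≤ κ) (q : ι) :
    ∃ s ≤ t, t ≤ s + τ ∧ κ * (hi - y s q) ≤ hi - new := by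
  obtain ⟨w₀, w, σ, h1, h2, h4, h5⟩ := h.exists_gap_eq hi
  refine ⟨σ q, (h4 q).1, (h4 q).2, ?_⟩
  have h6 : w q * (hi - y (σ q) q) ≤ ∑ q, w q * (hi - y (σ q) q) :=
    Finset.single_le_sum (f := fun q => w q * (hi - y (σ q) q)) (fun q _ =>
      mul_nonneg (hκ.trans (h2 q)) (sub_nonneg.2 (hy _ (h4 q).1 (h4 q).2 q))) (Finset.mem_univ q)
  have h7 := mul_le_mul_of_nonneg_right (h2 q) (sub_nonneg.2 (hy _ (h4 q).1 (h4 q).2 q))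
  have h8 := mul_nonneg (hκ.trans h1) (sub_nonneg.2 hold)
  linarith

theorem le_of_le (h : IsDelayedMean κ τ t y old new) (hκ : 0 ≤ κ) : new ≤ hi := by
  have h1 := h.mul_gap_old_le hold hy hκ
  have h2 := mul_nonneg hκ (sub_nonneg.2 hold)
  linarith

end IsDelayedMean

/-- From time `T₀` on, every entry of `x` is either kept or replaced by a delayed mean with the
entries of `y`, and the latter happens in every time window of length `B + 1`. -/
structure IsMixedBy (κ : ℝ) (τ B T₀ : ℕ) (x y : ℕ → ι → ℝ) : Prop where
  step : ∀ t, T₀ ≤ t → ∀ p, x (t + 1) p = x t p ∨ IsDelayedMean κ τ t y (x t p) (x (t + 1) p)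
  exists_mean : ∀ t, T₀ ≤ t → ∀ p, ∃ s, t ≤ s ∧ s ≤ t + B ∧
    IsDelayedMean κ τ s y (x s p) (x (s + 1) p)

namespace IsMixedBy

variable {κ : ℝ} {τ B T₀ : ℕ} {x y : ℕ → ι → ℝ}

theorem neg (h : IsMixedBy κ τ B T₀ x y) : IsMixedBy κ τ B T₀ (-x) (-y) where
  step t ht p := (h.step t ht p).imp (fun h => by simp [h]) fun h => by simpa using h.neg
  exists_mean t ht p := by
    obtain ⟨s, h1, h2, h3⟩ := h.exists_mean t ht p
    exact ⟨s, h1, h2, by simpa using h3.neg⟩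

theorem mono (h : IsMixedBy κ τ B T₀ x y) {κ' : ℝ} (hκ : κ' ≤ κ) : IsMixedBy κ' τ B T₀ x y where
  step t ht p := (h.step t ht p).imp_right fun h => h.mono hκ
  exists_mean t ht p := by
    obtain ⟨s, h1, h2, h3⟩ := h.exists_mean t ht p
    exact ⟨s, h1, h2, h3.mono hκ⟩

/-- A gap below a common upper bound decays at most geometrically. -/
theorem pow_mul_gap_le (h : IsMixedBy κ τ B T₀ x y) (hκ : 0 ≤ κ) (hκ1 : κ ≤ 1) {T : ℕ} {hi : ℝ}
    (hT : T₀ ≤ T) (hx : ∀ s, T ≤ s → ∀ p, x s p ≤ hi) (hy : ∀ s, T ≤ s → ∀ p, y s p ≤ hi)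
    {t : ℕ} (ht : T + τ ≤ t) (p : ι) (n : ℕ) :
    κ ^ n * (hi - x t p) ≤ hi - x (t + n) p := by
  induction n with
  | zero => simp
  | succ n ih =>
    have hg : 0 ≤ hi - x (t + n) p := sub_nonneg.2 (hx _ (by omega) p)
    have hstep : κ * (hi - x (t + n) p) ≤ hi - x (t + n + 1) p := by
      rcases h.step (t + n) (by omega) p with h1 | h1
      · rw [h1]; exact mul_le_of_le_one_left hg hκ1
      · exact h1.mul_gap_old_le (hx _ (by omega) p) (fun s _ hs => hy s (by omega)) hκ
    calc κ ^ (n + 1) * (hi - x t p) = κ * (κ ^ n * (hi - x t p)) := by ring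
      _ ≤ κ * (hi - x (t + n) p) := mul_le_mul_of_nonneg_left ih hκ
      _ ≤ _ := hstep

/-- A gap of one entry of `y` over a time interval spreads to all entries of `x`. -/
theorem pow_mul_le_gap (h : IsMixedBy κ τ B T₀ x y) (hκ : 0 ≤ κ) (hκ1 : κ ≤ 1) {T : ℕ} {hi : ℝ}
    (hT : T₀ ≤ T) (hx : ∀ s, T ≤ s → ∀ p, x s p ≤ hi) (hy : ∀ s, T ≤ s → ∀ p, y s p ≤ hi)
    {T₁ T₂ N : ℕ} (hT₁ : T ≤ T₁) (hN : T₂ ≤ T₁ + N) {q : ι} {d : ℝ} (hd : 0 ≤ d)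
    (hgap : ∀ t, T₁ ≤ t → t ≤ T₂ → d ≤ hi - y t q) (p : ι) {t : ℕ} (ht : T₁ + τ + B + 1 ≤ t)
    (ht₂ : t ≤ T₂) : κ ^ (N + 1) * d ≤ hi - x t p := by
  obtain ⟨s, hs1, hs2, hs⟩ := h.exists_mean (T₁ + τ) (by omega) p
  obtain ⟨r, hr1, hr2, hr⟩ := hs.exists_mul_gap_le (hx s (by omega) p)
    (fun s' _ hs' => hy s' (by omega)) hκ q
  obtain ⟨n, rfl⟩ : ∃ n, t = s + 1 + n := ⟨t - (s + 1), by omega⟩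
  calc κ ^ (N + 1) * d ≤ κ ^ (n + 1) * d :=
        mul_le_mul_of_nonneg_right (pow_le_pow_of_le_one hκ hκ1 (by omega)) hd
    _ = κ ^ n * (κ * d) := by ring
    _ ≤ κ ^ n * (hi - x (s + 1) p) := by
        refine mul_le_mul_of_nonneg_left (le_trans ?_ hr) (pow_nonneg hκ n)
        exact mul_le_mul_of_nonneg_left (hgap r (by omega) (by omega)) hκ
    _ ≤ _ := h.pow_mul_gap_le hκ hκ1 hT hx hy (by omega) p n

end IsMixedBy

variable {κ : ℝ} {τ B T₀ : ℕ} {x y : ℕ → ι → ℝ}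

/-- An upper bound which holds over a time window of length `τ + 1` holds ever after. -/
theorem le_of_le_on_window (hxy : IsMixedBy κ τ B T₀ x y) (hyx : IsMixedBy κ τ B T₀ y x)
    (hκ : 0 ≤ κ) {T : ℕ} (hT : T₀ ≤ T) {hi : ℝ}
    (hx : ∀ s, T ≤ s → s ≤ T + τ → ∀ p, x s p ≤ hi)
    (hy : ∀ s, T ≤ s → s ≤ T + τ → ∀ p, y s p ≤ hi) :
    ∀ s, T ≤ s → (∀ p, x s p ≤ hi) ∧ ∀ p, y s p ≤ hi := by
  intro s
  induction s using Nat.strong_induction_on with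
  | _ s ih =>
    intro hs
    rcases le_or_gt s (T + τ) with h | h
    · exact ⟨hx s hs h, hy s hs h⟩
    · obtain ⟨t, rfl⟩ : ∃ t, s = t + 1 := ⟨s - 1, by omega⟩
      have h0 := ih t (by omega) (by omega)
      constructor <;> intro p
      · rcases hxy.step t (by omega) p with h1 | h1
        · rw [h1]; exact h0.1 p
        · exact h1.le_of_le (h0.1 p) (fun r _ _ => (ih r (by omega) (by omega)).2) hκ
      · rcases hyx.step t (by omega) p with h1 | h1
        · rw [h1]; exact h0.2 p
        · exact h1.le_of_le (h0.2 p) (fun r _ _ => (ih r (by omega) (by omega)).1) hκ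

/-- The length of the time span over which a gap reaches all entries. -/
def mixingTime (τ B : ℕ) : ℕ := 3 * τ + 2 * B + 2

/-- The gap of one entry of x spreads to all entries of y, and from there back to all entries of x.
Once both families have a gap throughout a window of length τ + 1, the improved bound lasts forever.
The exponent 3 N + 2 is N for keeping the first gap alive plus N + 1 for each of the two spreadings.
-/
theorem upper_bound_improves (hxy : IsMixedBy κ τ B T₀ x y) (hyx : IsMixedBy κ τ B T₀ y x)
    (hκ : 0 ≤ κ) (hκ1 : κ ≤ 1) {T : ℕ} (hT : T₀ ≤ T) {hi : ℝ}
    (hb : ∀ s, T ≤ s → (∀ p, x s p ≤ hi) ∧ ∀ p, y s p ≤ hi) (p₀ : ι) {d : ℝ} (hd : 0 ≤ d)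
    (hgap : d ≤ hi - x (T + τ) p₀) :
    ∀ s, T + mixingTime τ B ≤ s → (∀ p, x s p ≤ hi - κ ^ (3 * mixingTime τ B + 2) * d) ∧
      ∀ p, y s p ≤ hi - κ ^ (3 * mixingTime τ B + 2) * d := by
  set N := mixingTime τ B with hN
  unfold mixingTime at hN
  have hx := fun s hs => (hb s hs).1
  have hy := fun s hs => (hb s hs).2
  have h1 : ∀ t, T + τ ≤ t → t ≤ T + τ + N → κ ^ N * d ≤ hi - x t p₀ := by
    intro t ht ht'
    obtain ⟨n, rfl⟩ : ∃ n, t = T + τ + n := ⟨t - (T + τ), by omega⟩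
    calc κ ^ N * d ≤ κ ^ n * d :=
          mul_le_mul_of_nonneg_right (pow_le_pow_of_le_one hκ hκ1 (by omega)) hd
      _ ≤ κ ^ n * (hi - x (T + τ) p₀) := mul_le_mul_of_nonneg_left hgap (pow_nonneg hκ n)
      _ ≤ _ := hxy.pow_mul_gap_le hκ hκ1 hT hx hy le_rfl p₀ n
  have hd1 : 0 ≤ κ ^ N * d := mul_nonneg (pow_nonneg hκ _) hd
  have h2 : ∀ q t, T + τ + τ + B + 1 ≤ t → t ≤ T + τ + N →
      κ ^ (N + 1) * (κ ^ N * d) ≤ hi - y t q := fun q t ht ht' =>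
    hyx.pow_mul_le_gap hκ hκ1 hT hy hx (by omega) le_rfl hd1 h1 q ht ht'
  have hd2 : 0 ≤ κ ^ (N + 1) * (κ ^ N * d) := mul_nonneg (pow_nonneg hκ _) hd1
  -- Each spreading costs τ + B + 1 time units; starting from T + τ, two of them end exactly at T +
  -- N.
  have h3 : ∀ q t, T + N ≤ t → t ≤ T + N + τ →
      κ ^ (N + 1) * (κ ^ (N + 1) * (κ ^ N * d)) ≤ hi - x t q := fun q t ht ht' =>
    hxy.pow_mul_le_gap hκ hκ1 hT hx hy (T₁ := T + τ + τ + B + 1) (T₂ := T + τ + N) (by omega)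
      (by omega) hd2 (h2 p₀) q (by omega) (by omega)
  have he : κ ^ (N + 1) * (κ ^ (N + 1) * (κ ^ N * d)) = κ ^ (3 * N + 2) * d := by ring
  have h4 : κ ^ (N + 1) * (κ ^ (N + 1) * (κ ^ N * d)) ≤ κ ^ (N + 1) * (κ ^ N * d) :=
    mul_le_of_le_one_left hd2 (pow_le_one₀ hκ hκ1)
  rw [he] at h3 h4
  refine le_of_le_on_window hxy hyx hκ (by omega) (fun s hs hs' p => ?_) fun s hs hs' p => ?_
  · linarith [h3 p s hs hs']
  · linarith [h2 p s (by omega) (by omega)]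

/-- From time `T` on, all entries of `x` and `y` lie between `lo` and `hi`. -/
def IsTrapped (x y : ℕ → ι → ℝ) (T : ℕ) (lo hi : ℝ) : Prop :=
  ∀ s, T ≤ s → ∀ p, (lo ≤ x s p ∧ x s p ≤ hi) ∧ lo ≤ y s p ∧ y s p ≤ hi

omit [Fintype ι] in
theorem IsTrapped.mono {T T' : ℕ} {lo hi : ℝ} (h : IsTrapped x y T lo hi) (hT : T ≤ T') :
    IsTrapped x y T' lo hi := fun s hs => h s (hT.trans hs)

/-- The factor by which the spread shrinks over one mixing time. -/
noncomputable def mixingRate (κ : ℝ) (τ B : ℕ) : ℝ := 1 - κ ^ (3 * mixingTime τ B + 2) / 2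

theorem mixingRate_lt_one (hκ : 0 < κ) (τ B : ℕ) : mixingRate κ τ B < 1 := by
  unfold mixingRate
  linarith [pow_pos hκ (3 * mixingTime τ B + 2)]

theorem mixingRate_pos (hκ : 0 ≤ κ) (hκ1 : κ ≤ 1) (τ B : ℕ) : 0 < mixingRate κ τ B := by
  unfold mixingRate
  linarith [pow_le_one₀ hκ hκ1 (n := 3 * mixingTime τ B + 2)]

/-- A chosen entry of x lies in the lower or the upper half of the interval, so its gap to one end
is at least half the length. That end moves; the case of the lower end follows by negating both
families. -/
theorem IsTrapped.contract [Nonempty ι] (hxy : IsMixedBy κ τ B T₀ x y)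
    (hyx : IsMixedBy κ τ B T₀ y x) (hκ : 0 ≤ κ) (hκ1 : κ ≤ 1) {T : ℕ} (hT : T₀ ≤ T) {lo hi : ℝ}
    (h : IsTrapped x y T lo hi) :
    ∃ lo' hi', lo ≤ lo' ∧ hi' ≤ hi ∧ hi' - lo' ≤ mixingRate κ τ B * (hi - lo) ∧
      IsTrapped x y (T + mixingTime τ B) lo' hi' := by
  obtain ⟨p₀⟩ := ‹Nonempty ι›
  have hle := h (T + τ) (by omega) p₀
  have hd : 0 ≤ (hi - lo) / 2 := by linarith [hle.1.1, hle.1.2]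
  have hδ : 0 ≤ κ ^ (3 * mixingTime τ B + 2) * ((hi - lo) / 2) := mul_nonneg (pow_nonneg hκ _) hd
  rcases le_total (x (T + τ) p₀) ((lo + hi) / 2) with hmid | hmid
  · have hup := upper_bound_improves hxy hyx hκ hκ1 hT
      (fun s hs => ⟨fun p => (h s hs p).1.2, fun p => (h s hs p).2.2⟩) p₀ hd (by linarith)
    refine ⟨lo, hi - κ ^ (3 * mixingTime τ B + 2) * ((hi - lo) / 2), le_rfl, by linarith, ?_,
      fun s hs p => ⟨⟨(h s (by omega) p).1.1, (hup s hs).1 p⟩,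
        (h s (by omega) p).2.1, (hup s hs).2 p⟩⟩
    unfold mixingRate; linarith
  · have hup := upper_bound_improves hxy.neg hyx.neg hκ hκ1 hT (hi := -lo)
      (fun s hs => ⟨fun p => neg_le_neg (h s hs p).1.1, fun p => neg_le_neg (h s hs p).2.1⟩) p₀ hd
      (by simp only [Pi.neg_apply]; linarith)
    refine ⟨lo + κ ^ (3 * mixingTime τ B + 2) * ((hi - lo) / 2), hi, by linarith, le_rfl, ?_,
      fun s hs p => ⟨⟨?_, (h s (by omega) p).1.2⟩, ?_, (h s (by omega) p).2.2⟩⟩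
    · unfold mixingRate; linarith
    · have := (hup s hs).1 p
      simp only [Pi.neg_apply] at this; linarith
    · have := (hup s hs).2 p
      simp only [Pi.neg_apply] at this; linarith

theorem IsTrapped.contract_iterate [Nonempty ι] (hxy : IsMixedBy κ τ B T₀ x y)
    (hyx : IsMixedBy κ τ B T₀ y x) (hκ : 0 ≤ κ) (hκ1 : κ ≤ 1) {lo hi : ℝ}
    (h : IsTrapped x y T₀ lo hi) (k : ℕ) :
    ∃ lo' hi', lo ≤ lo' ∧ hi' ≤ hi ∧ hi' - lo' ≤ mixingRate κ τ B ^ k * (hi - lo) ∧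
      IsTrapped x y (T₀ + k * mixingTime τ B) lo' hi' := by
  induction k with
  | zero => exact ⟨lo, hi, le_rfl, le_rfl, by simp, by simpa using h⟩
  | succ k ih =>
    obtain ⟨lo₁, hi₁, h1, h2, h3, h4⟩ := ih
    obtain ⟨lo₂, hi₂, h5, h6, h7, h8⟩ := h4.contract hxy hyx hκ hκ1 (by omega)
    refine ⟨lo₂, hi₂, h1.trans h5, h6.trans h2, h7.trans ?_, ?_⟩
    · rw [pow_succ', mul_assoc]
      exact mul_le_mul_of_nonneg_left h3 (mixingRate_pos hκ hκ1 τ B).le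
    · rwa [add_one_mul, ← add_assoc]

omit [Fintype ι] in
/-- Nested intervals of vanishing length trap a common limit. -/
theorem exists_limit_of_isTrapped [Nonempty ι] {lo₀ hi₀ : ℝ} {r : ℕ → ℝ}
    (h : ∀ t, ∃ lo hi, lo₀ ≤ lo ∧ hi ≤ hi₀ ∧ hi - lo ≤ r t ∧ IsTrapped x y t lo hi) :
    ∃ l, lo₀ ≤ l ∧ ∀ t p, |x t p - l| ≤ r t ∧ |y t p - l| ≤ r t := by
  choose lo hi h1 h2 h3 h4 using h
  obtain ⟨p₀⟩ := ‹Nonempty ι›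
  -- Both intervals contain the entries at the later of the two times, so any two of them meet and
  -- the supremum of the lower ends lies in all of them.
  have hle : ∀ t t', lo t ≤ hi t' := fun t t' =>
    ((h4 t (max t t') (le_max_left _ _) p₀).1.1).trans
      (h4 t' (max t t') (le_max_right _ _) p₀).1.2
  have hbdd : BddAbove (Set.range lo) := ⟨hi 0, by rintro _ ⟨t, rfl⟩; exact hle t 0⟩
  have hlo : ∀ t, lo t ≤ ⨆ t, lo t := fun t => le_ciSup hbdd t
  have hhi : ∀ t, ⨆ t, lo t ≤ hi t := fun t => ciSup_le fun t' => hle t' t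
  refine ⟨⨆ t, lo t, (h1 0).trans (hlo 0), fun t p => ?_⟩
  obtain ⟨⟨h5, h6⟩, h7, h8⟩ := h4 t t le_rfl p
  have := h3 t
  have := hlo t
  have := hhi t
  constructor <;> rw [abs_le] <;> constructor <;> linarith

/-- Some geometric sequence with ratio less than one decays no faster than `γ ^ (t / N)`. -/
theorem exists_pow_ge {γ : ℝ} (hγ : 0 < γ) (hγ1 : γ < 1) {N : ℕ} (hN : 0 < N) :
    ∃ ρ : ℝ, 0 < ρ ∧ ρ < 1 ∧ γ ≤ ρ ^ N := by
  have hN' : (1 : ℝ) ≤ N := by exact_mod_cast hN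
  have hN0 : (0 : ℝ) < N := by linarith
  have h1 : (1 - γ) / N ≤ 1 - γ := div_le_self (by linarith) hN'
  have h2 : 0 < (1 - γ) / N := div_pos (by linarith) hN0
  refine ⟨1 + -((1 - γ) / N), by linarith, by linarith, ?_⟩
  -- Bernoulli's inequality: ρ = 1 - (1 - γ) / N satisfies ρ ^ N ≥ 1 - (1 - γ).
  have h3 := one_add_mul_le_pow (a := -((1 - γ) / N)) (by linarith) N
  have h4 : (1 : ℝ) + N * -((1 - γ) / N) = γ := by field_simp; ring
  linarith

/-- If the coefficients of the means are at least `c * (lo / hi)` as long as the entries are between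
`lo` and `hi`, consensus is reached at a linear rate which does not depend on the initial
entries. -/
theorem exists_consensus_rate [Nonempty ι] {c : ℝ} (hc : 0 < c) (hc1 : c ≤ 1) (τ B : ℕ) :
    ∃ ρ : ℝ, 0 < ρ ∧ ρ < 1 ∧ ∀ lo₀ hi₀ : ℝ, 0 < lo₀ → lo₀ ≤ hi₀ → ∃ M : ℝ,
      ∀ x y : ℕ → ι → ℝ, IsTrapped x y 0 lo₀ hi₀ →
        (∀ T lo hi, 0 < lo → IsTrapped x y T lo hi →
          IsMixedBy (c * (lo / hi)) τ B (T + τ) x y ∧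
          IsMixedBy (c * (lo / hi)) τ B (T + τ) y x) →
        ∃ l, lo₀ ≤ l ∧ ∀ t p, |x t p - l| ≤ M * ρ ^ t ∧ |y t p - l| ≤ M * ρ ^ t := by
  have hc2 : 0 < c / 2 := by linarith
  have hc21 : c / 2 ≤ 1 := by linarith
  have hN : 0 < mixingTime τ B := by unfold mixingTime; omega
  obtain ⟨ρ, hρ, hρ1, hγρ⟩ :=
    exists_pow_ge (mixingRate_pos hc2.le hc21 τ B) (mixingRate_lt_one hc2 τ B) hN
  refine ⟨ρ, hρ, hρ1, fun lo₀ hi₀ hlo hle => ?_⟩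
  have hhi : 0 < hi₀ := hlo.trans_le hle
  have hκ : 0 < c * (lo₀ / hi₀) := mul_pos hc (div_pos hlo hhi)
  have hκ1 : c * (lo₀ / hi₀) ≤ 1 :=
    mul_le_one₀ hc1 (div_pos hlo hhi).le ((div_le_one hhi).2 hle)
  have hS : 0 ≤ hi₀ - lo₀ := sub_nonneg.2 hle
  -- After n mixing times the spread is below lo₀, hence hi₁ ≤ 2 lo₁. The added 1 keeps the
  -- denominator positive when hi₀ = lo₀.
  obtain ⟨n, hn⟩ := exists_pow_lt_of_lt_one (div_pos hlo (by linarith : 0 < hi₀ - lo₀ + 1))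
    (mixingRate_lt_one hκ τ B)
  rw [lt_div_iff₀ (by linarith)] at hn
  have hn0 := pow_nonneg (mixingRate_pos hκ.le hκ1 τ B).le n
  set N := mixingTime τ B with hNdef
  set T := τ + n * N + τ with hT
  have hρT : 0 < ρ ^ (T + N) := pow_pos hρ _
  -- Dividing by ρ ^ (T + N) covers the transient t < T and the rounding in (t - T) / N.
  refine ⟨(hi₀ - lo₀) / ρ ^ (T + N), fun x y htrap hmix => ?_⟩
  refine exists_limit_of_isTrapped (lo₀ := lo₀) (hi₀ := hi₀) fun t => ?_
  rcases lt_or_ge t T with ht | ht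
  · refine ⟨lo₀, hi₀, le_rfl, le_rfl, ?_, htrap.mono (Nat.zero_le t)⟩
    rw [div_mul_eq_mul_div, le_div_iff₀ hρT]
    exact mul_le_mul_of_nonneg_left (pow_le_pow_of_le_one hρ.le hρ1.le (by omega)) hS
  · have hmix₀ := hmix 0 lo₀ hi₀ hlo htrap
    rw [zero_add] at hmix₀
    obtain ⟨lo₁, hi₁, h1, h2, h3, h4⟩ :=
      (htrap.mono (Nat.zero_le τ)).contract_iterate hmix₀.1 hmix₀.2 hκ.le hκ1 n
    have hlo₁ : 0 < lo₁ := hlo.trans_le h1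
    have hle₁ : lo₁ ≤ hi₁ := by
      obtain ⟨p⟩ := ‹Nonempty ι›
      have := h4 _ le_rfl p
      exact this.1.1.trans this.1.2
    have hhi₁ : 0 < hi₁ := hlo₁.trans_le hle₁
    have hmix₁ := hmix _ lo₁ hi₁ hlo₁ h4
    have hκ₁ : c / 2 ≤ c * (lo₁ / hi₁) := by
      rw [div_eq_mul_one_div]
      refine mul_le_mul_of_nonneg_left ?_ hc.le
      rw [div_le_div_iff₀ two_pos hhi₁]
      nlinarith
    obtain ⟨lo₂, hi₂, h5, h6, h7, h8⟩ := (h4.mono (Nat.le_add_right _ τ)).contract_iterate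
      (hmix₁.1.mono hκ₁) (hmix₁.2.mono hκ₁) hc2.le hc21 ((t - T) / N)
    have hdiv := Nat.div_add_mod (t - T) N
    have hmod := Nat.mod_lt (t - T) hN
    rw [mul_comm] at hdiv
    refine ⟨lo₂, hi₂, h1.trans h5, h6.trans h2, h7.trans ?_, h8.mono (by rw [← hNdef]; omega)⟩
    rw [div_mul_eq_mul_div, le_div_iff₀ hρT]
    have hγ0 := mixingRate_pos hc2.le hc21 τ B
    calc mixingRate (c / 2) τ B ^ ((t - T) / N) * (hi₁ - lo₁) * ρ ^ (T + N)
        ≤ (ρ ^ N) ^ ((t - T) / N) * (hi₀ - lo₀) * ρ ^ (T + N) := by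
          refine mul_le_mul_of_nonneg_right ?_ hρT.le
          exact mul_le_mul (pow_le_pow_left₀ hγ0.le hγρ _) (by linarith) (by linarith)
            (pow_nonneg (pow_nonneg hρ.le _) _)
      _ = (hi₀ - lo₀) * ρ ^ ((t - T) / N * N + (T + N)) := by
          rw [pow_add ρ (_ * N), pow_mul']; ring
      _ ≤ (hi₀ - lo₀) * ρ ^ t :=
          mul_le_mul_of_nonneg_left (pow_le_pow_of_le_one hρ.le hρ1.le (by omega)) hS

end Consensus

/-! ### Damped means as convex combinations -/

section Means

variable {ι : Type*} [Fintype ι] [Nonempty ι] {P y : ι → ℝ} {α η lo hi : ℝ}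

/-- A damped weighted harmonic mean is a convex combination. -/
theorem exists_weights_of_harmonic (hP : ∀ q, 0 < P q) (hη : ∀ q, η * ∑ r, P r ≤ P q) (hη0 : 0 ≤ η)
    (hη1 : η ≤ 1) (hα : 0 < α) (hα1 : α < 1) (hlo : 0 < lo) (hy : ∀ q, lo ≤ y q ∧ y q ≤ hi)
    (old : ℝ) :
    ∃ (w₀ : ℝ) (w : ι → ℝ), α * (1 - α) * η * (lo / hi) ≤ w₀ ∧
      (∀ q, α * (1 - α) * η * (lo / hi) ≤ w q) ∧ w₀ + ∑ q, w q = 1 ∧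
      α * ((∑ q, P q) / ∑ q, P q / y q) + (1 - α) * old = w₀ * old + ∑ q, w q * y q := by
  have hypos : ∀ q, 0 < y q := fun q => hlo.trans_le (hy q).1
  have hhi : 0 < hi := (hypos (Classical.arbitrary ι)).trans_le (hy _).2
  have hratio : lo / hi ≤ 1 := (div_le_one hhi).2 ((hy (Classical.arbitrary ι)).1.trans (hy _).2)
  have hratio0 : 0 < lo / hi := div_pos hlo hhi
  have hα1' : 0 < 1 - α := by linarith
  have hD : 0 < ∑ q, P q / y q :=
    Finset.sum_pos (fun q _ => div_pos (hP q) (hypos q)) Finset.univ_nonempty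
  have hDle : (∑ q, P q / y q) * lo ≤ ∑ q, P q := by
    rw [Finset.sum_mul]
    refine Finset.sum_le_sum fun q _ => ?_
    rw [div_mul_eq_mul_div, div_le_iff₀ (hypos q)]
    exact mul_le_mul_of_nonneg_left (hy q).1 (hP q).le
  have hsmall : η * (lo / hi) ≤ 1 := mul_le_one₀ hη1 hratio0.le hratio
  refine ⟨1 - α, fun q => α * (P q / y q) / ∑ q, P q / y q, ?_, fun q => ?_, ?_, ?_⟩
  · calc α * (1 - α) * η * (lo / hi) = (1 - α) * (α * (η * (lo / hi))) := by ring
      _ ≤ (1 - α) * 1 := mul_le_mul_of_nonneg_left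
          (mul_le_one₀ hα1.le (mul_nonneg hη0 hratio0.le) hsmall) hα1'.le
      _ = _ := mul_one _
  · rw [le_div_iff₀ hD]
    calc α * (1 - α) * η * (lo / hi) * ∑ q, P q / y q
        = (1 - α) * (α * (η * ((∑ q, P q / y q) * lo)) / hi) := by ring
      _ ≤ 1 * (α * P q / hi) := by
          refine mul_le_mul (by linarith) ?_ (by positivity) one_pos.le
          refine div_le_div_of_nonneg_right (mul_le_mul_of_nonneg_left ?_ hα.le) hhi.le
          exact (mul_le_mul_of_nonneg_left hDle hη0).trans (hη q)
      _ = α * (P q / hi) := by ring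
      _ ≤ α * (P q / y q) := mul_le_mul_of_nonneg_left
          (div_le_div_of_nonneg_left (hP q).le (hypos q) (hy q).2) hα.le
  · rw [← Finset.sum_div, ← Finset.mul_sum, mul_div_assoc, div_self hD.ne']
    ring
  · have : ∀ q, α * (P q / y q) / (∑ q, P q / y q) * y q = α / (∑ q, P q / y q) * P q := by
      intro q
      have := (hypos q).ne'
      field_simp
    simp only [this, ← Finset.mul_sum]
    ring

/-- The harmonic damping of a weighted arithmetic mean is a convex combination. -/
theorem exists_weights_of_arithmetic (hP : ∀ q, 0 < P q) (hη : ∀ q, η * ∑ r, P r ≤ P q)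
    (hη0 : 0 ≤ η) (hη1 : η ≤ 1) (hα : 0 < α) (hα1 : α < 1) (hlo : 0 < lo)
    (hy : ∀ q, lo ≤ y q ∧ y q ≤ hi) {old : ℝ} (hold : lo ≤ old ∧ old ≤ hi) :
    ∃ (w₀ : ℝ) (w : ι → ℝ), α * (1 - α) * η * (lo / hi) ≤ w₀ ∧
      (∀ q, α * (1 - α) * η * (lo / hi) ≤ w q) ∧ w₀ + ∑ q, w q = 1 ∧
      (α * ((∑ q, P q) / ∑ q, P q * y q) + (1 - α) / old)⁻¹ = w₀ * old + ∑ q, w q * y q := by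
  have hypos : ∀ q, 0 < y q := fun q => hlo.trans_le (hy q).1
  have hopos : 0 < old := hlo.trans_le hold.1
  have hhi : 0 < hi := hopos.trans_le hold.2
  have hα1' : 0 < 1 - α := by linarith
  have hb : 0 < ∑ q, P q := Finset.sum_pos (fun q _ => hP q) Finset.univ_nonempty
  have hS : 0 < ∑ q, P q * y q :=
    Finset.sum_pos (fun q _ => mul_pos (hP q) (hypos q)) Finset.univ_nonempty
  have hSle : ∑ q, P q * y q ≤ (∑ q, P q) * hi := by
    rw [Finset.sum_mul]
    exact Finset.sum_le_sum fun q _ => mul_le_mul_of_nonneg_left (hy q).2 (hP q).le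
  have hSge : (∑ q, P q) * lo ≤ ∑ q, P q * y q := by
    rw [Finset.sum_mul]
    exact Finset.sum_le_sum fun q _ => mul_le_mul_of_nonneg_left (hy q).1 (hP q).le
  set b := ∑ q, P q with hbdef
  set S := ∑ q, P q * y q with hSdef
  set r := α * (b / S) + (1 - α) / old with hr
  have hrpos : 0 < r := by positivity
  have hrle : r * lo ≤ 1 := by
    have h1 : b / S * lo ≤ 1 := by rw [div_mul_eq_mul_div]; exact (div_le_one hS).2 hSge
    have h2 : lo / old ≤ 1 := (div_le_one hopos).2 hold.1
    calc r * lo = α * (b / S * lo) + (1 - α) * (lo / old) := by rw [hr]; ring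
      _ ≤ α * 1 + (1 - α) * 1 := add_le_add (mul_le_mul_of_nonneg_left h1 hα.le)
          (mul_le_mul_of_nonneg_left h2 hα1'.le)
      _ = 1 := by ring
  -- Here r is the reciprocal of the new value; the weights come from splitting 1 = r / r into its
  -- two summands.
  refine ⟨(1 - α) / (old * r), fun q => α * P q / (S * r), ?_, fun q => ?_, ?_, ?_⟩
  · rw [le_div_iff₀ (mul_pos hopos hrpos)]
    have h1 : old / hi ≤ 1 := (div_le_one hhi).2 hold.2
    calc α * (1 - α) * η * (lo / hi) * (old * r)
        = (1 - α) * (α * (η * ((old / hi) * (r * lo)))) := by ring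
      _ ≤ (1 - α) * 1 := by
          refine mul_le_mul_of_nonneg_left ?_ hα1'.le
          refine mul_le_one₀ hα1.le (by positivity) (mul_le_one₀ hη1 (by positivity) ?_)
          exact mul_le_one₀ h1 (by positivity) hrle
      _ = _ := mul_one _
  · rw [le_div_iff₀ (mul_pos hS hrpos)]
    have h1 : S / hi ≤ b := (div_le_iff₀ hhi).2 hSle
    calc α * (1 - α) * η * (lo / hi) * (S * r)
        = (1 - α) * (α * (η * ((S / hi) * (r * lo)))) := by ring
      _ ≤ 1 * (α * P q) := by
          refine mul_le_mul (by linarith) ?_ (by positivity) one_pos.le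
          refine mul_le_mul_of_nonneg_left ((mul_le_mul_of_nonneg_left ?_ hη0).trans (hη q)) hα.le
          calc S / hi * (r * lo) ≤ b * 1 := mul_le_mul h1 hrle (by positivity) hb.le
            _ = b := mul_one b
      _ = _ := one_mul _
  · rw [← Finset.sum_div, ← Finset.mul_sum, ← hbdef]
    calc (1 - α) / (old * r) + α * b / (S * r) = r / r := by
          conv_rhs => enter [1]; rw [hr]
          field_simp
          ring
      _ = 1 := div_self hrpos.ne'
  · have : ∀ q, α * P q / (S * r) * y q = α / (S * r) * (P q * y q) := fun q => by ring
    simp only [this, ← Finset.mul_sum, ← hSdef]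
    field_simp
    ring

end Means

/-! ### Half-steps of a bounded schedule -/

namespace AsyncSchedule

variable {c : ℕ} {S : AsyncSchedule c}

theorem halfSteps_succ_of_mem {t : ℕ} {i : Fin c} (h : i ∈ S.active t) :
    S.halfSteps (t + 1) i = S.halfSteps t i + 1 := by
  simp [halfSteps, Nat.count_succ, h]

theorem exists_next_active {τ : ℕ} (hS : S.IsBounded τ) (t : ℕ) (i : Fin c) :
    ∃ s, t ≤ s ∧ s ≤ t + τ ∧ i ∈ S.active s ∧ S.halfSteps s i = S.halfSteps t i := by
  classical
  have hex : ∃ n, i ∈ S.active (t + n) := by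
    obtain ⟨s, h1, -, h3⟩ := hS.exists_active t i
    exact ⟨s - t, by rwa [Nat.add_sub_cancel' h1]⟩
  refine ⟨t + Nat.find hex, by omega, ?_, Nat.find_spec hex, ?_⟩
  · obtain ⟨s, h1, h2, h3⟩ := hS.exists_active t i
    have := Nat.find_min' hex (m := s - t) (by rwa [Nat.add_sub_cancel' h1])
    omega
  · have : ∀ n ≤ Nat.find hex, S.halfSteps (t + n) i = S.halfSteps t i := by
      intro n
      induction n with
      | zero => intro; rfl
      | succ n ih =>
        intro hn
        rw [← ih (by omega)]
        simp [halfSteps, ← add_assoc, Nat.count_succ, Nat.find_min hex (m := n) (by omega)]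
    exact this _ le_rfl

/-- In `2 τ + 2` consecutive time units each client completes half-steps of both kinds. -/
theorem exists_active_even_odd {τ : ℕ} (hS : S.IsBounded τ) (t : ℕ) (i : Fin c) :
    (∃ s, t ≤ s ∧ s ≤ t + (2 * τ + 1) ∧ i ∈ S.active s ∧ Even (S.halfSteps s i)) ∧
    ∃ s, t ≤ s ∧ s ≤ t + (2 * τ + 1) ∧ i ∈ S.active s ∧ Odd (S.halfSteps s i) := by
  obtain ⟨s₁, h1, h2, h3, -⟩ := exists_next_active hS t i
  -- Two successive half-steps of a client have counters of opposite parity.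
  obtain ⟨s₂, h5, h6, h7, h8⟩ := exists_next_active hS (s₁ + 1) i
  rw [halfSteps_succ_of_mem h3] at h8
  rcases Nat.even_or_odd (S.halfSteps s₁ i) with h | h
  · exact ⟨⟨s₁, h1, by omega, h3, h⟩, s₂, by omega, by omega, h7, h8 ▸ h.add_one⟩
  · exact ⟨⟨s₂, by omega, by omega, h7, h8 ▸ h.add_one⟩, s₁, h1, by omega, h3, h⟩

end AsyncSchedule

/-! ### The run in ratio coordinates -/

namespace IsAsyncSinkhornRun

variable {c m : ℕ} {K : Matrix (Fin c × Fin m) (Fin c × Fin m) ℝ} {a b us vs : Fin c × Fin m → ℝ}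
  {α η lo hi : ℝ} {τ : ℕ} {S : AsyncSchedule c} {u v : ℕ → Fin c × Fin m → ℝ}

/-- Writing P_pq = us_p K_pq vs_q, one has us_p (K v̂)_p = ∑ P_pq / ŷ_q, and a_p is the p-th row sum
of P. So a_p / (us_p (K v̂)_p) is the harmonic mean of ŷ with weights P_pq. -/
theorem isDelayedMean_u [Nonempty (Fin c × Fin m)] (hrun : IsAsyncSinkhornRun K a b α S u v)
    (hS : S.IsBounded τ) (h : IsSinkhornFixedPoint K a b us vs) (hK : ∀ p q, 0 < K p q)
    (hα : 0 < α) (hα1 : α < 1) (hη0 : 0 ≤ η) (hη1 : η ≤ 1)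
    (hη : ∀ p q, η * a p ≤ us p * K p q * vs q) (hlo : 0 < lo) {t : ℕ}
    (hv : ∀ s ≤ t, t ≤ s + τ → ∀ q, lo ≤ vs q / v s q ∧ vs q / v s q ≤ hi) {p : Fin c × Fin m}
    (hact : p.1 ∈ S.active t) (heven : Even (S.halfSteps t p.1)) :
    IsDelayedMean (α * (1 - α) * η * (lo / hi)) τ t (fun s q => vs q / v s q) (u t p / us p)
      (u (t + 1) p / us p) := by
  have hstamp := fun q : Fin c × Fin m => And.intro (hS.stamp_le t p.1 q.1) (hS.le_stamp_add t p.1 q.1)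
  have hsum := h.sum_row hK p
  obtain ⟨w₀, w, h1, h2, h3, h4⟩ := exists_weights_of_harmonic
    (P := fun q => us p * K p q * vs q)
    (y := fun q => vs q / v (S.stamp t p.1 q.1) q)
    (fun q => mul_pos (mul_pos (h.u_pos p) (hK p q)) (h.v_pos q))
    (fun q => by rw [hsum]; exact hη p q) hη0 hη1 hα hα1 hlo
    (fun q => hv _ (hstamp q).1 (hstamp q).2 q) (u t p / us p)
  refine ⟨w₀, w, fun q => S.stamp t p.1 q.1, h1, h2, h3, hstamp, ?_⟩
  rw [← h4, hsum]
  have h5 := hrun.u_step t p.1 p.2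
  rw [if_pos ⟨hact, heven⟩] at h5
  have h6 : ∑ q, us p * K p q * vs q / (vs q / v (S.stamp t p.1 q.1) q)
      = us p * (K *ᵥ S.read v t p.1) p := by
    rw [Matrix.mulVec, dotProduct, Finset.mul_sum]
    refine Finset.sum_congr rfl fun q _ => ?_
    rw [AsyncSchedule.read, mul_div_assoc, div_div_cancel₀ (h.v_pos q).ne', mul_assoc]
  rw [h6, h5]
  rw [add_div, mul_comm (us p), ← div_div]
  ring

/-- Dually, vs_q (Kᵀ û)_q = ∑ P_pq x̂_p with column sum b_q. The damping is linear in v, hence in 1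
/ y, which makes the new y_q a harmonic mean. -/
theorem isDelayedMean_v [Nonempty (Fin c × Fin m)] (hrun : IsAsyncSinkhornRun K a b α S u v)
    (hS : S.IsBounded τ) (h : IsSinkhornFixedPoint K a b us vs) (hK : ∀ p q, 0 < K p q)
    (hα : 0 < α) (hα1 : α < 1) (hη0 : 0 ≤ η) (hη1 : η ≤ 1)
    (hη : ∀ p q, η * b q ≤ us p * K p q * vs q) (hlo : 0 < lo) {t : ℕ}
    (hu : ∀ s ≤ t, t ≤ s + τ → ∀ p, lo ≤ u s p / us p ∧ u s p / us p ≤ hi) {q : Fin c × Fin m}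
    (hv : lo ≤ vs q / v t q ∧ vs q / v t q ≤ hi)
    (hact : q.1 ∈ S.active t) (hodd : Odd (S.halfSteps t q.1)) :
    IsDelayedMean (α * (1 - α) * η * (lo / hi)) τ t (fun s p => u s p / us p) (vs q / v t q)
      (vs q / v (t + 1) q) := by
  have hstamp := fun p : Fin c × Fin m => And.intro (hS.stamp_le t q.1 p.1) (hS.le_stamp_add t q.1 p.1)
  have hsum := h.sum_col hK q
  obtain ⟨w₀, w, h1, h2, h3, h4⟩ := exists_weights_of_arithmetic
    (P := fun p => us p * K p q * vs q)
    (y := fun p => u (S.stamp t q.1 p.1) p / us p)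
    (fun p => mul_pos (mul_pos (h.u_pos p) (hK p q)) (h.v_pos q))
    (fun p => by rw [hsum]; exact hη p q) hη0 hη1 hα hα1 hlo
    (fun p => hu _ (hstamp p).1 (hstamp p).2 p) hv
  refine ⟨w₀, w, fun p => S.stamp t q.1 p.1, h1, h2, h3, hstamp, ?_⟩
  rw [← h4, hsum]
  have h5 := hrun.v_step t q.1 q.2
  rw [if_pos ⟨hact, hodd⟩] at h5
  have h6 : ∑ p, us p * K p q * vs q * (u (S.stamp t q.1 p.1) p / us p)
      = vs q * (Kᵀ *ᵥ S.read u t q.1) q := by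
    rw [Matrix.mulVec, dotProduct, Finset.mul_sum]
    refine Finset.sum_congr rfl fun p _ => ?_
    have := (h.u_pos p).ne'
    rw [AsyncSchedule.read, Matrix.transpose_apply]
    field_simp
  rw [h6, h5, ← inv_div _ (vs q)]
  rw [add_div, mul_comm (vs q), ← div_div, div_div_eq_mul_div]
  ring

end IsAsyncSinkhornRun

theorem exists_pos_le_forall_le {ι : Type*} [Finite ι] [Nonempty ι] {f : ι → ℝ}
    (hf : ∀ i, 0 < f i) : ∃ lo hi, 0 < lo ∧ ∀ i, lo ≤ f i ∧ f i ≤ hi := by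
  obtain ⟨i, hi⟩ := Finite.exists_min f
  obtain ⟨j, hj⟩ := Finite.exists_max f
  exact ⟨f i, f j, hf i, fun k => ⟨hi k, hj k⟩⟩

namespace IsAsyncSinkhornRun

variable {c m : ℕ} {K : Matrix (Fin c × Fin m) (Fin c × Fin m) ℝ} {a b us vs : Fin c × Fin m → ℝ}
  {α η lo hi : ℝ} {τ : ℕ} {S : AsyncSchedule c} {u v : ℕ → Fin c × Fin m → ℝ}

theorem isTrapped [Nonempty (Fin c × Fin m)] (hrun : IsAsyncSinkhornRun K a b α S u v)
    (hS : S.IsBounded τ) (h : IsSinkhornFixedPoint K a b us vs) (hK : ∀ p q, 0 < K p q)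
    (hα : 0 < α) (hα1 : α < 1) (hlo : 0 < lo) (hu₀ : ∀ p, lo ≤ u 0 p / us p ∧ u 0 p / us p ≤ hi)
    (hv₀ : ∀ p, lo ≤ vs p / v 0 p ∧ vs p / v 0 p ≤ hi) :
    IsTrapped (fun s p => u s p / us p) (fun s q => vs q / v s q) 0 lo hi := by
  -- Trapping needs only convexity, so η = 0 suffices and all weight bounds become 0.
  have hP : ∀ p q, 0 * a p ≤ us p * K p q * vs q ∧ 0 * b q ≤ us p * K p q * vs q := fun p q => by
    rw [zero_mul, zero_mul, and_self]
    exact (mul_pos (mul_pos (h.u_pos p) (hK p q)) (h.v_pos q)).le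
  have bounds : ∀ {t : ℕ} {y : ℕ → Fin c × Fin m → ℝ} {old new : ℝ},
      IsDelayedMean (α * (1 - α) * 0 * (lo / hi)) τ t y old new → (lo ≤ old ∧ old ≤ hi) →
      (∀ s ≤ t, t ≤ s + τ → ∀ q, lo ≤ y s q ∧ y s q ≤ hi) → lo ≤ new ∧ new ≤ hi := by
    intro t y old new hm hold hy
    rw [mul_zero, zero_mul] at hm
    exact ⟨neg_le_neg_iff.1 (hm.neg.le_of_le (neg_le_neg hold.1)
      (fun s h1 h2 q => neg_le_neg (hy s h1 h2 q).1) le_rfl),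
      hm.le_of_le hold.2 (fun s h1 h2 q => (hy s h1 h2 q).2) le_rfl⟩
  intro s _
  induction s using Nat.strong_induction_on with
  | _ s ih =>
    intro p
    rcases s with _ | t
    · exact ⟨hu₀ p, hv₀ p⟩
    · have hold := ih t (Nat.lt_succ_self t) (Nat.zero_le _) p
      have hx : ∀ s ≤ t, t ≤ s + τ → ∀ q, lo ≤ u s q / us q ∧ u s q / us q ≤ hi :=
        fun s hs _ q => (ih s (by omega) (Nat.zero_le _) q).1
      have hy : ∀ s ≤ t, t ≤ s + τ → ∀ q, lo ≤ vs q / v s q ∧ vs q / v s q ≤ hi :=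
        fun s hs _ q => (ih s (by omega) (Nat.zero_le _) q).2
      constructor
      · by_cases hact : p.1 ∈ S.active t ∧ Even (S.halfSteps t p.1)
        · exact bounds (hrun.isDelayedMean_u hS h hK hα hα1 le_rfl zero_le_one
            (fun p q => (hP p q).1) hlo hy hact.1 hact.2) hold.1 hy
        · have := hrun.u_step t p.1 p.2
          rw [if_neg hact] at this
          simpa only [this] using hold.1
      · by_cases hact : p.1 ∈ S.active t ∧ Odd (S.halfSteps t p.1)
        · exact bounds (hrun.isDelayedMean_v hS h hK hα hα1 le_rfl zero_le_one
            (fun p q => (hP p q).2) hlo hx hold.2 hact.1 hact.2) hold.2 hx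
        · have := hrun.v_step t p.1 p.2
          rw [if_neg hact] at this
          simpa only [this] using hold.2

/-- From T + τ on, every value read dates from T or later and so lies in [lo, hi]. The window 2 τ +
1 is the time in which a client is sure to perform both kinds of half-step. -/
theorem isMixedBy [Nonempty (Fin c × Fin m)] (hrun : IsAsyncSinkhornRun K a b α S u v)
    (hS : S.IsBounded τ) (h : IsSinkhornFixedPoint K a b us vs) (hK : ∀ p q, 0 < K p q)
    (hα : 0 < α) (hα1 : α < 1) (hη0 : 0 ≤ η) (hη1 : η ≤ 1)
    (hη : ∀ p q, η * a p ≤ us p * K p q * vs q ∧ η * b q ≤ us p * K p q * vs q) (hlo : 0 < lo)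
    {T : ℕ} (htrap : IsTrapped (fun s p => u s p / us p) (fun s q => vs q / v s q) T lo hi) :
    IsMixedBy (α * (1 - α) * η * (lo / hi)) τ (2 * τ + 1) (T + τ) (fun s p => u s p / us p)
      (fun s q => vs q / v s q) ∧
    IsMixedBy (α * (1 - α) * η * (lo / hi)) τ (2 * τ + 1) (T + τ) (fun s q => vs q / v s q)
      (fun s p => u s p / us p) := by
  have hu : ∀ t, T + τ ≤ t → ∀ p : Fin c × Fin m, p.1 ∈ S.active t →
      Even (S.halfSteps t p.1) → IsDelayedMean (α * (1 - α) * η * (lo / hi)) τ t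
        (fun s q => vs q / v s q) (u t p / us p) (u (t + 1) p / us p) := fun t ht p h1 h2 =>
    hrun.isDelayedMean_u hS h hK hα hα1 hη0 hη1 (fun p q => (hη p q).1) hlo
      (fun s _ hs q => (htrap s (by omega) q).2) h1 h2
  have hv : ∀ t, T + τ ≤ t → ∀ p : Fin c × Fin m, p.1 ∈ S.active t →
      Odd (S.halfSteps t p.1) → IsDelayedMean (α * (1 - α) * η * (lo / hi)) τ t
        (fun s p => u s p / us p) (vs p / v t p) (vs p / v (t + 1) p) := fun t ht p h1 h2 =>
    hrun.isDelayedMean_v hS h hK hα hα1 hη0 hη1 (fun p q => (hη p q).2) hlo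
      (fun s _ hs q => (htrap s (by omega) q).1) (htrap t (by omega) p).2 h1 h2
  refine ⟨⟨fun t ht p => ?_, fun t ht p => ?_⟩, ⟨fun t ht p => ?_, fun t ht p => ?_⟩⟩
  · by_cases hact : p.1 ∈ S.active t ∧ Even (S.halfSteps t p.1)
    · exact Or.inr (hu t ht p hact.1 hact.2)
    · have := hrun.u_step t p.1 p.2
      rw [if_neg hact] at this
      exact Or.inl (congrArg (· / us p) this)
  · obtain ⟨s, h1, h2, h3, h4⟩ := (AsyncSchedule.exists_active_even_odd hS t p.1).1
    exact ⟨s, h1, h2, hu s (ht.trans h1) p h3 h4⟩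
  · by_cases hact : p.1 ∈ S.active t ∧ Odd (S.halfSteps t p.1)
    · exact Or.inr (hv t ht p hact.1 hact.2)
    · have := hrun.v_step t p.1 p.2
      rw [if_neg hact] at this
      exact Or.inl (congrArg (vs p / ·) this)
  · obtain ⟨s, h1, h2, h3, h4⟩ := (AsyncSchedule.exists_active_even_odd hS t p.1).2
    exact ⟨s, h1, h2, hv s (ht.trans h1) p h3 h4⟩

end IsAsyncSinkhornRun

/-! ### Linear convergence to a fixed point -/

theorem exists_linear_rate {c m : ℕ} [Nonempty (Fin c × Fin m)]
    {K : Matrix (Fin c × Fin m) (Fin c × Fin m) ℝ} (hK : ∀ p q, 0 < K p q)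
    {a b us vs : Fin c × Fin m → ℝ} (h : IsSinkhornFixedPoint K a b us vs) (ha : ∀ p, 0 < a p)
    (hb : ∀ p, 0 < b p) {α : ℝ} (hα : 0 < α) (hα1 : α < 1) (τ : ℕ) :
    ∃ ρ : ℝ, 0 < ρ ∧ ρ < 1 ∧
      ∀ u₀ v₀ : Fin c × Fin m → ℝ, (∀ p, 0 < u₀ p) → (∀ p, 0 < v₀ p) →
        ∃ M lo : ℝ, 0 < lo ∧
          ∀ (S : AsyncSchedule c) (u v : ℕ → Fin c × Fin m → ℝ),
            S.IsBounded τ → IsAsyncSinkhornRun K a b α S u v → u 0 = u₀ → v 0 = v₀ →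
            ∃ l, lo ≤ l ∧ ∀ t p, lo ≤ vs p / v t p ∧
              |u t p / us p - l| ≤ M * ρ ^ t ∧ |vs p / v t p - l| ≤ M * ρ ^ t := by
  have hP : ∀ p q, 0 < us p * K p q * vs q := fun p q =>
    mul_pos (mul_pos (h.u_pos p) (hK p q)) (h.v_pos q)
  -- η bounds from below the share of each entry of P in its row sum and in its column sum; it
  -- depends only on the fixed point.
  obtain ⟨η₀, _, hη₀, hη⟩ := exists_pos_le_forall_le
    (f := fun r : (Fin c × Fin m) × (Fin c × Fin m) =>
      min (us r.1 * K r.1 r.2 * vs r.2 / a r.1) (us r.1 * K r.1 r.2 * vs r.2 / b r.2))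
    fun r => lt_min (div_pos (hP _ _) (ha _)) (div_pos (hP _ _) (hb _))
  set η := min η₀ 1 with hηdef
  have hη0 : 0 < η := lt_min hη₀ one_pos
  have hη1 : η ≤ 1 := min_le_right _ _
  have hηP : ∀ p q, η * a p ≤ us p * K p q * vs q ∧ η * b q ≤ us p * K p q * vs q := by
    intro p q
    have h1 := (min_le_left η₀ 1).trans (hη (p, q)).1
    exact ⟨(le_div_iff₀ (ha p)).1 (h1.trans (min_le_left _ _)),
      (le_div_iff₀ (hb q)).1 (h1.trans (min_le_right _ _))⟩
  have hα1' : 0 < 1 - α := by linarith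
  obtain ⟨ρ, hρ, hρ1, hrate⟩ := exists_consensus_rate (ι := Fin c × Fin m)
    (c := α * (1 - α) * η) (by positivity)
    (mul_le_one₀ (mul_le_one₀ hα1.le hα1'.le (by linarith)) hη0.le hη1) τ (2 * τ + 1)
  refine ⟨ρ, hρ, hρ1, fun u₀ v₀ hu₀ hv₀ => ?_⟩
  obtain ⟨lo, hi, hlo, hbd⟩ := exists_pos_le_forall_le
    (f := Sum.elim (fun p => u₀ p / us p) fun p => vs p / v₀ p) (by
      rintro (p | p)
      · exact div_pos (hu₀ p) (h.u_pos p)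
      · exact div_pos (h.v_pos p) (hv₀ p))
  have hle : lo ≤ hi := (hbd (Sum.inl (Classical.arbitrary _))).1.trans (hbd _).2
  obtain ⟨M, hcons⟩ := hrate lo hi hlo hle
  refine ⟨M, lo, hlo, fun S u v hS hrun hu hv => ?_⟩
  subst hu hv
  have htrap := hrun.isTrapped hS h hK hα hα1 hlo (fun p => hbd (Sum.inl p))
    fun p => hbd (Sum.inr p)
  obtain ⟨l, hl, hlim⟩ := hcons _ _ htrap fun T lo hi hlo htrap =>
    hrun.isMixedBy hS h hK hα hα1 hη0.le hη1 hηP hlo htrap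
  exact ⟨l, hl, fun t p => ⟨(htrap t (Nat.zero_le t) p).2.1, hlim t p⟩⟩

theorem abs_mul_sub_mul_le {w x y r B : ℝ} (hw : 0 ≤ w) (hwB : w ≤ B) (h : |x - y| ≤ r) :
    |w * x - w * y| ≤ B * r := by
  rw [← mul_sub, abs_mul, abs_of_nonneg hw]
  exact mul_le_mul hwB h (abs_nonneg _) (hw.trans hwB)

theorem abs_inv_sub_inv_le {lo x y r : ℝ} (hlo : 0 < lo) (hx : lo ≤ x) (hy : lo ≤ y)
    (h : |x - y| ≤ r) : |x⁻¹ - y⁻¹| ≤ r / (lo * lo) := by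
  have hx0 := hlo.trans_le hx
  have hy0 := hlo.trans_le hy
  rw [inv_sub_inv hx0.ne' hy0.ne', abs_div, abs_sub_comm, abs_of_pos (mul_pos hx0 hy0)]
  exact div_le_div₀ ((abs_nonneg _).trans h) h (mul_pos hlo hlo) (mul_le_mul hx hy hlo.le hx0.le)

theorem abs_div_sub_one_le {lo x y z r : ℝ} (hlo : 0 < lo) (hy : lo ≤ y)
    (hx : |x - z| ≤ r) (hyz : |y - z| ≤ r) : |x / y - 1| ≤ 2 * r / lo := by
  have hy0 := hlo.trans_le hy
  rw [div_sub_one hy0.ne', abs_div, abs_of_pos hy0]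
  have h1 : |x - y| ≤ 2 * r := by
    have := abs_sub_le x z y
    rw [abs_sub_comm z y] at this
    linarith
  exact div_le_div₀ ((abs_nonneg _).trans h1) h1 hlo hy

theorem proposition2 (c m : ℕ) (hc : 0 < c) (hm : 0 < m)
    (a b : Fin c × Fin m → ℝ) (ha : ∀ p, 0 < a p) (hb : ∀ p, 0 < b p)
    (hab : ∑ p, a p = ∑ p, b p)
    (C : Matrix (Fin c × Fin m) (Fin c × Fin m) ℝ) (hC : ∀ p q, 0 ≤ C p q)
    (ε : ℝ) (hε : 0 < ε) (τ : ℕ) :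
    ∃ Pstar : Matrix (Fin c × Fin m) (Fin c × Fin m) ℝ,
      (∀ Q, IsEntropicOTSolution C ε a b Q ↔ Q = Pstar) ∧
      (∃ u v, IsSinkhornFixedPoint (gibbsKernel C ε) a b u v) ∧
      (∀ u v, IsSinkhornFixedPoint (gibbsKernel C ε) a b u v →
        scaledKernel (gibbsKernel C ε) u v = Pstar) ∧
      (∀ u v u' v', IsSinkhornFixedPoint (gibbsKernel C ε) a b u v →
        IsSinkhornFixedPoint (gibbsKernel C ε) a b u' v' →
        ∃ s : ℝ, 0 < s ∧ u' = s • u ∧ v' = s⁻¹ • v) ∧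
      ∃ α₀ : ℝ, 0 < α₀ ∧ α₀ ≤ 1 ∧ ∀ α : ℝ, 0 < α → α < α₀ →
        ∃ ρ : ℝ, 0 < ρ ∧ ρ < 1 ∧
          ∀ u₀ v₀ : Fin c × Fin m → ℝ, (∀ p, 0 < u₀ p) → (∀ p, 0 < v₀ p) →
            ∃ M : ℝ, ∀ (S : AsyncSchedule c) (u v : ℕ → Fin c × Fin m → ℝ),
              S.IsBounded τ → IsAsyncSinkhornRun (gibbsKernel C ε) a b α S u v →
              u 0 = u₀ → v 0 = v₀ →
              ∃ ustar vstar : Fin c × Fin m → ℝ,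
                IsSinkhornFixedPoint (gibbsKernel C ε) a b ustar vstar ∧
                ∀ t p, |u t p - ustar p| ≤ M * ρ ^ t ∧ |v t p - vstar p| ≤ M * ρ ^ t ∧
                  ∀ q, |scaledKernel (gibbsKernel C ε) (u t) (v t) p q - Pstar p q|
                    ≤ M * ρ ^ t := by
  have : Nonempty (Fin c × Fin m) := ⟨(⟨0, hc⟩, ⟨0, hm⟩)⟩
  have hK := gibbsKernel_pos C ε
  obtain ⟨us, vs, h⟩ := exists_isSinkhornFixedPoint hK ha hb hab
  have heq : ∀ u v, IsSinkhornFixedPoint (gibbsKernel C ε) a b u v →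
      scaledKernel (gibbsKernel C ε) u v = scaledKernel (gibbsKernel C ε) us vs := fun u v h' =>
    (isEntropicOTSolution_iff hε h _).1 ((isEntropicOTSolution_iff hε h' _).2 rfl)
  refine ⟨scaledKernel (gibbsKernel C ε) us vs, isEntropicOTSolution_iff hε h, ⟨us, vs, h⟩, heq,
    fun u v u' v' h1 h2 => exists_smul_of_scaledKernel_eq hK h1.u_pos h1.v_pos h2.u_pos h2.v_pos
      ((heq u v h1).trans (heq u' v' h2).symm), 1, one_pos, le_rfl, fun α hα hα1 => ?_⟩
  obtain ⟨ρ, hρ, hρ1, hrate⟩ := exists_linear_rate hK h ha hb hα hα1 τ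
  refine ⟨ρ, hρ, hρ1, fun u₀ v₀ hu₀ hv₀ => ?_⟩
  obtain ⟨M, lo, hlo, hrun⟩ := hrate u₀ v₀ hu₀ hv₀
  obtain ⟨_, U, -, hU⟩ := exists_pos_le_forall_le h.u_pos
  obtain ⟨_, V, -, hV⟩ := exists_pos_le_forall_le h.v_pos
  have hP : ∀ r : (Fin c × Fin m) × (Fin c × Fin m),
      0 < us r.1 * gibbsKernel C ε r.1 r.2 * vs r.2 := fun r =>
    mul_pos (mul_pos (h.u_pos _) (hK _ _)) (h.v_pos _)
  obtain ⟨_, W, -, hW⟩ := exists_pos_le_forall_le hP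
  refine ⟨max (U * M) (max (V * (M / (lo * lo))) (W * (2 * M / lo))), fun S u v hS hSrun hu hv => ?_⟩
  obtain ⟨l, hl, hlim⟩ := hrun S u v hS hSrun hu hv
  have hl0 := hlo.trans_le hl
  refine ⟨l • us, l⁻¹ • vs, h.smul hl0, fun t p => ?_⟩
  have hρt : 0 ≤ ρ ^ t := pow_nonneg hρ.le t
  have hu' : ∀ p, u t p = us p * (u t p / us p) := fun p =>
    (mul_div_cancel₀ _ (h.u_pos p).ne').symm
  have hv' : ∀ p, v t p = vs p * (vs p / v t p)⁻¹ := fun p => by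
    rw [inv_div, mul_div_cancel₀ _ (h.v_pos p).ne']
  refine ⟨?_, ?_, fun q => ?_⟩
  · refine le_trans ?_ (mul_le_mul_of_nonneg_right (le_max_left _ _) hρt)
    rw [hu' p, Pi.smul_apply, smul_eq_mul, mul_comm l, mul_assoc]
    exact abs_mul_sub_mul_le (h.u_pos p).le (hU p).2 (hlim t p).2.1
  · refine le_trans ?_ (mul_le_mul_of_nonneg_right
      ((le_max_left _ _).trans (le_max_right _ _)) hρt)
    rw [hv' p, Pi.smul_apply, smul_eq_mul, mul_comm l⁻¹, mul_assoc, div_mul_eq_mul_div]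
    exact abs_mul_sub_mul_le (h.v_pos p).le (hV p).2
      (abs_inv_sub_inv_le hlo (hlim t p).1 hl (hlim t p).2.2)
  · refine le_trans ?_ (mul_le_mul_of_nonneg_right
      ((le_max_right _ _).trans (le_max_right _ _)) hρt)
    -- The entry equals P*_pq x_p / y_q, and both ratios are close to the same l, so the quotient is
    -- close to 1.
    have h1 : scaledKernel (gibbsKernel C ε) (u t) (v t) p q
        = us p * gibbsKernel C ε p q * vs q * (u t p / us p / (vs q / v t q)) := by
      calc scaledKernel (gibbsKernel C ε) (u t) (v t) p q
          = us p * (u t p / us p) * gibbsKernel C ε p q * (vs q * (vs q / v t q)⁻¹) := by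
            rw [scaledKernel_apply, ← hu' p, ← hv' q]
        _ = _ := by rw [div_eq_mul_inv _ (vs q / v t q)]; ring
    have h2 : scaledKernel (gibbsKernel C ε) us vs p q
        = us p * gibbsKernel C ε p q * vs q * 1 := by
      rw [scaledKernel_apply, mul_one]
    rw [h1, h2, mul_assoc W, div_mul_eq_mul_div, mul_assoc 2]
    exact abs_mul_sub_mul_le (hP (p, q)).le (hW (p, q)).2
      (abs_div_sub_one_le hlo (hlim t q).1 (hlim t p).2.1 (hlim t q).2.2)
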